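/- Let $D$ be a finite set of data symbols, let $\Box\notin D$ be the blank, $D_\Box=D\cup\{\Box\}$, and let $\#,\mu,\infty$ be further special symbols. Let $\mathcal A=\{i?x,\ o!x \mid x\in D\cup\{\#\}\}$ be the set of actions, and $\mathcal A_\tau=\mathcal A\cup\{\tau\}$. *Persistent Turing machines.* A persistent Turing machine (PTM) $M$ over $D$ is a nondeterministic Turing machine with finitely many states, tape symbols $D_\Box$, and three semi-infinite tapes: a read-only input tape, a read/write work tape and a write-only output tape (a left move in the leftmost cell leaves the head in place). A configuration from which no step is possible is halted. The content of a tape is the word in $D^*$ at the beginning of the tape, up to the first blank. Consider the computations of $M$ from its initial state, with all heads at the beginning of the tapes and with input, work and output tape containing $w_i$, $w$ and $\varepsilon$, respectively. There is a macrostep $w\xrightarrow{w_i/w_o}w'$ if some such computation reaches a halted configuration in which the contents of the work and output tapes are $w'$ and $w_o$, and there is a macrostep $w\xrightarrow{w_i/\mu}\infty$ if some such computation is infinite. The interactive transition system $\mathcal I(M)$ has as states all elements of $D^*\cup\{\infty\}$ that are reachable from $\varepsilon$ by macrosteps, has initial state $\varepsilon$, and has the macrosteps as transitions. *Encoding.*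 The transition system $\mathcal T(M)$ has states $s_{i,w}$ ($w\in D^*$) and $s_{o,w}$ ($w\in D^*\cup\{\mu\}$) for every state $s$ of $\mathcal I(M)$, initial state $\varepsilon_{i,\varepsilon}$, no final states, and the transitions $$s_{i,w}\xrightarrow{i?d}s_{i,wd},\quad s_{o,dw}\xrightarrow{o!d}s_{o,w},\quad s_{o,\mu}\xrightarrow{\tau}s_{o,\mu},\quad s_{o,\varepsilon}\xrightarrow{o!\#}s_{i,\varepsilon}\qquad(d\in D,\ w\in D^*),$$ and $s_{i,w_i}\xrightarrow{i?\#}s'_{o,w_o}$ whenever $s\xrightarrow{w_i/w_o}s'$ in $\mathcal I(M)$. *Reactive Turing machines.* A reactive Turing machine (RTM) with data symbols $E$ (a finite set not containing $\Box$) consists of a finite set of states, an initial state, a set of final states, and a transition relation whose elements $(s,d,a,e,m,t)$, with $d,e\in E_\Box$, $a\in\mathcal A_\tau$ and $m\in\{L,R\}$, mean: in state $s$, reading $d$, perform $a$, write $e$, move the head one cell in direction $m$, and go to state $t$. Its transition system $\mathcal T(N)$ has as states the configurations (a state, together with a two-way infinite tape that is blank almost everywhere and a head position), with the corresponding $\mathcal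 A_\tau$-labelled transitions. It starts in the initial state with blank tape, and a configuration is final iff its state is. *Branching bisimilarity.* Write $\twoheadrightarrow$ for the reflexive-transitive closure of $\xrightarrow{\tau}$, and $s\xrightarrow{(a)}t$ if $s\xrightarrow{a}t$, or $a=\tau$ and $s=t$. A branching bisimulation between two transition systems is a relation $R$ between their states such that $s_1\,R\,s_2$ implies: (1) if $s_1\xrightarrow{a}s_1'$, then there are $s_2'',s_2'$ with $s_2\twoheadrightarrow s_2''\xrightarrow{(a)}s_2'$, $s_1\,R\,s_2''$ and $s_1'\,R\,s_2'$; (2) if $s_1$ is final, then there is a final $s_2'$ with $s_2\twoheadrightarrow s_2'$ and $s_1\,R\,s_2'$; and symmetrically for transitions and finality of $s_2$. Two transition systems are branching bisimilar, $T_1\leftrightarroweq_{\mathrm b}T_2$, if some branching bisimulation relates their initial states. **Statement.** For every finite set $D$ of data symbols there is a finite set $X$ of auxiliary tape symbols, disjoint from $D\cup\{\Box\}$, such that for every PTM $M$ over $D$ there exists an RTM $N$ with actions $\mathcal A$ and data symbols $D\cup X$ such that $\mathcal T(M)\leftrightarroweq_{\mathrm b}\mathcal T(N)$. -/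

import Mathlib

open Relation

universe u v

/-! ### Labelled transition systems and branching bisimilarity -/

/-- A transition system over the action symbols `A`. Labels are elements of `Option A`;
`none` is the unobservable action `τ`. -/
structure LTS (A : Type u) where
  State : Type v
  step : State → Option A → State → Prop
  start : State
  final : Set State

namespace LTS

variable {A : Type u}

/-- `s` goes to `t` by a single unobservable transition. -/
def tau (T : LTS A) (s t : T.State) : Prop := T.step s none t

/-- `s` goes to `t` by finitely many (possibly zero) unobservable transitions. -/
def taus (T : LTS A) : T.State → T.State → Prop := ReflTransGen T.tau

/-- An optional transition: an `a`-transition, or `a = τ` and the state does not change. -/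
def optStep (T : LTS A) (s : T.State) (a : Option A) (t : T.State) : Prop :=
  T.step s a t ∨ (a = none ∧ s = t)

/-- `R` is a branching bisimulation from `T₁` to `T₂`. -/
structure IsBranchingBisimulation (T₁ : LTS A) (T₂ : LTS A)
    (R : T₁.State → T₂.State → Prop) : Prop where
  step_left : ∀ s₁ s₂, R s₁ s₂ → ∀ a t₁, T₁.step s₁ a t₁ →
    ∃ u₂ t₂, T₂.taus s₂ u₂ ∧ T₂.optStep u₂ a t₂ ∧ R s₁ u₂ ∧ R t₁ t₂
  step_right : ∀ s₁ s₂, R s₁ s₂ → ∀ a t₂, T₂.step s₂ a t₂ →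
    ∃ u₁ t₁, T₁.taus s₁ u₁ ∧ T₁.optStep u₁ a t₁ ∧ R u₁ s₂ ∧ R t₁ t₂
  final_left : ∀ s₁ s₂, R s₁ s₂ → s₁ ∈ T₁.final →
    ∃ t₂, T₂.taus s₂ t₂ ∧ R s₁ t₂ ∧ t₂ ∈ T₂.final
  final_right : ∀ s₁ s₂, R s₁ s₂ → s₂ ∈ T₂.final →
    ∃ t₁, T₁.taus s₁ t₁ ∧ R t₁ s₂ ∧ t₁ ∈ T₁.final

/-- Branching bisimilarity of transition systems. -/
def BranchingBisimilar (T₁ : LTS A) (T₂ : LTS A) : Prop :=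
  ∃ R : T₁.State → T₂.State → Prop, IsBranchingBisimulation T₁ T₂ R ∧ R T₁.start T₂.start

end LTS

/-! ### Reactive Turing machines -/

/-- A reactive Turing machine with action symbols `A` and data symbols `E`. A tape symbol is an
element of `Option E`, where `none` is the blank. `trans s d a e M t` says that in state `s`,
reading `d`, the machine may perform the action `a` (`none` is `τ`), write `e`, move its head
one cell in the direction `M`, and continue in state `t`. -/
structure RTM (A : Type u) (E : Type v) where
  State : Type
  finite_state : Finite State
  start : State
  final : Set State
  trans : State → Option E → Option A → Option E → Turing.Dir → State → Prop

namespace RTM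

variable {A : Type u} {E : Type v}

/-- The transition system of a reactive Turing machine. Its states are the configurations: a
control state with a two-way infinite tape, blank almost everywhere, with a head position.
(`Turing.Tape` identifies tapes up to blanks at the two extremes.) -/
def toLTS (M : RTM A E) : LTS A where
  State := M.State × Turing.Tape (Option E)
  step c a c' := ∃ (e : Option E) (m : Turing.Dir),
    M.trans c.1 c.2.head a e m c'.1 ∧ c'.2 = (c.2.write e).move m
  start := (M.start, default)
  final := {c | c.1 ∈ M.final}

end RTM

/-! ### Interactive transition systems -/

/-- The output component of a macrostep: a word, or `μ` (divergence). -/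
inductive Output (D : Type u) : Type u where
  | word : List D → Output D
  | mu : Output D

/-- An interactive transition system over `D`. `IsDiv` singles out the special divergence state
`∞`, if it is present. No enumerability is imposed on `tr`. -/
structure ITS (D : Type u) where
  State : Type u
  start : State
  IsDiv : State → Prop
  tr : State → List D → Output D → State → Prop
  isDiv_unique : ∀ s t, IsDiv s → IsDiv t → s = t
  reachable : ∀ s, ReflTransGen (fun s t => ∃ wi wo, tr s wi wo t) start s
  tr_to_div : ∀ s wi wo t, tr s wi wo t → IsDiv t → wo = Output.mu
  tr_from_div : ∀ s wi wo t, tr s wi wo t → IsDiv s → IsDiv t ∧ wo = Output.mu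

/-- The symbols that can be communicated: data symbols and the end marker `#`. -/
inductive PortSymbol (D : Type u) : Type u where
  | data : D → PortSymbol D
  | hash : PortSymbol D

/-- The actions `i?x` (receive `x` along the input channel) and `o!x` (send `x` along the output
channel), for `x` a data symbol or `#`. -/
inductive PortAction (D : Type u) : Type u where
  | recv : PortSymbol D → PortAction D
  | send : PortSymbol D → PortAction D

namespace ITS

variable {D : Type u}

/-- The states `s_{i,w}` (input mode) and `s_{o,w}` (output mode) of the encoding. -/
inductive EncState (S : Type u) (D : Type u) : Type u where
  | inp : S → List D → EncState S D
  | out : S → Output D → EncState S D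

/-- The transitions of the encoding of an interactive transition system. -/
inductive EncStep (I : ITS D) :
    EncState I.State D → Option (PortAction D) → EncState I.State D → Prop where
  | recv (s : I.State) (w : List D) (d : D) :
      EncStep I (.inp s w) (some (.recv (.data d))) (.inp s (w ++ [d]))
  | send (s : I.State) (d : D) (w : List D) :
      EncStep I (.out s (.word (d :: w))) (some (.send (.data d))) (.out s (.word w))
  | diverge (s : I.State) :
      EncStep I (.out s .mu) none (.out s .mu)
  | macrostep (s : I.State) (wi : List D) (wo : Output D) (t : I.State) (h : I.tr s wi wo t) :
      EncStep I (.inp s wi) (some (.recv .hash)) (.out t wo)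
  | finish (s : I.State) :
      EncStep I (.out s (.word [])) (some (.send .hash)) (.inp s [])

/-- The transition system encoding an interactive transition system. It starts in input mode in
the initial state with no input received yet, and has no final states. -/
def toLTS (I : ITS D) : LTS (PortAction D) where
  State := EncState I.State D
  step := EncStep I
  start := .inp I.start []
  final := ∅

end ITS

/-! ### Persistent Turing machines -/

/-- Head movements on a semi-infinite tape. -/
inductive HeadMove : Type where
  | left
  | stay
  | right

/-- The new position of the head; in cell `0`, a move to the left leaves the head in place. -/
def HeadMove.apply : HeadMove → ℕ → ℕ
  | .left, n => n - 1
  | .stay, n => n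
  | .right, n => n + 1

/-- A persistent Turing machine with data symbols `D`: a nondeterministic Turing machine with a
read-only input tape, a read/write work tape and a write-only output tape, each semi-infinite.
Tape symbols are elements of `Option D`, where `none` is the blank.

`trans q a b q' b' x mi mw mo` says that in state `q`, reading `a` on the input tape and `b` on
the work tape, the machine may write `b'` on the work tape, write on the output tape the symbol
`y` if `x = some y` (and nothing if `x = none`), move the heads of the input, work and output
tapes according to `mi`, `mw` and `mo`, and continue in state `q'`. -/
structure PTM (D : Type u) where
  State : Type v
  finite_state : Finite State
  start : State
  trans : State → Option D → Option D → State → Option D → Option (Option D) →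
    HeadMove → HeadMove → HeadMove → Prop

namespace PTM

variable {D : Type u}

/-- A semi-infinite tape, with cells numbered from `0`, and its head position. -/
structure HalfTape (D : Type u) where
  cell : ℕ → Option D
  head : ℕ

namespace HalfTape

/-- The tape containing the word `w` followed by blanks, with the head at the beginning. -/
def ofWord (w : List D) : HalfTape D where
  cell n := w[n]?
  head := 0

/-- The symbol under the head. -/
def read (t : HalfTape D) : Option D := t.cell t.head

/-- Write a symbol in the cell under the head. -/
def write (t : HalfTape D) (b : Option D) : HalfTape D where
  cell := Function.update t.cell t.head b
  head := t.head

/-- Move the head. -/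
def move (t : HalfTape D) (m : HeadMove) : HalfTape D where
  cell := t.cell
  head := m.apply t.head

/-- `w` is the content of the tape: the word in `D*` that stands at the beginning of the tape,
up to (and excluding) the first blank cell. -/
def Contains (t : HalfTape D) (w : List D) : Prop :=
  ∀ n ≤ w.length, t.cell n = w[n]?

end HalfTape

/-- Configurations of a persistent Turing machine. -/
structure Config (M : PTM.{u, v} D) where
  state : M.State
  input : HalfTape D
  work : HalfTape D
  output : HalfTape D

/-- The configuration in which a macrostep starts. -/
def startConfig (M : PTM.{u, v} D) (w wi : List D) : M.Config where
  state := M.start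
  input := .ofWord wi
  work := .ofWord w
  output := .ofWord []

/-- A single computation step. -/
def Step (M : PTM.{u, v} D) (c c' : M.Config) : Prop :=
  ∃ (b : Option D) (x : Option (Option D)) (mi mw mo : HeadMove),
    M.trans c.state c.input.read c.work.read c'.state b x mi mw mo ∧
    c'.input = c.input.move mi ∧
    c'.work = (c.work.write b).move mw ∧
    c'.output = (match x with
      | none => c.output
      | some y => c.output.write y).move mo

/-- A configuration is halted if no computation step is possible from it. -/
def Halted (M : PTM.{u, v} D) (c : M.Config) : Prop := ∀ c', ¬ M.Step c c'

/-- A state of the interactive transition system: a word (the content of the work tape), or the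
divergence state `∞`. -/
inductive MacroState (D : Type u) : Type u where
  | word : List D → MacroState D
  | infinity : MacroState D

/-- The macrosteps of a persistent Turing machine. -/
inductive Macrostep (M : PTM.{u, v} D) :
    MacroState D → List D → Output D → MacroState D → Prop where
  /-- Some halting computation leaves `w'` on the work tape and `wo` on the output tape. -/
  | halt (w wi wo w' : List D) (c : M.Config) (hc : ReflTransGen M.Step (M.startConfig w wi) c)
      (hh : M.Halted c) (hw : c.work.Contains w') (ho : c.output.Contains wo) :
      Macrostep M (.word w) wi (.word wo) (.word w')
  /-- Some computation is infinite. -/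
  | diverge (w wi : List D) (c : ℕ → M.Config) (h0 : c 0 = M.startConfig w wi)
      (hs : ∀ n, M.Step (c n) (c (n + 1))) :
      Macrostep M (.word w) wi .mu .infinity

/-- Reachability by macrosteps from the empty word. -/
def Reachable (M : PTM.{u, v} D) (s : MacroState D) : Prop :=
  ReflTransGen (fun s t => ∃ wi wo, M.Macrostep s wi wo t) (.word []) s

/-- The interactive transition system of a persistent Turing machine: its states are the words
(and possibly `∞`) that are reachable by macrosteps from the empty word, and its transitions are
the macrosteps. -/
def toITS (M : PTM.{u, v} D) : ITS D where
  State := {s : MacroState D // M.Reachable s}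
  start := ⟨.word [], ReflTransGen.refl⟩
  IsDiv s := s.1 = .infinity
  tr s wi wo t := M.Macrostep s.1 wi wo t.1
  isDiv_unique s t hs ht := Subtype.ext (hs.trans ht.symm)
  reachable := by
    rintro ⟨s, hs⟩
    induction hs with
    | refl => exact ReflTransGen.refl
    | tail hab hbc ih => exact ReflTransGen.tail ih hbc
  tr_to_div := by
    rintro ⟨s, _⟩ wi wo ⟨t, _⟩ h ht
    cases h with
    | halt => simp at ht
    | diverge => rfl
  tr_from_div := by
    rintro ⟨s, _⟩ wi wo ⟨t, _⟩ h hs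
    cases h <;> simp at hs

/-- The transition system associated with a persistent Turing machine. -/
def toLTS (M : PTM.{u, v} D) : LTS (PortAction D) := M.toITS.toLTS

end PTM

/-!
A persistent Turing machine is simulated up to branching bisimilarity by letting all its
nondeterminism be resolved in advance. While the simulating machine receives the input of a
macrostep, it repeatedly increments a number, the guess, by inert `τ`-steps. Reading `#` freezes the
guess `e`, and from then on the simulation is the evaluation of a deterministic partial recursive
function: if `e` encodes a halted configuration of the computation tree, then this is the result;
otherwise the tree is searched exhaustively, and by König's lemma the search diverges only if some
computation is infinite. Since every outcome is obtained from arbitrarily large guesses, each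
macrostep remains possible in every state of the input mode, so that the steps of the counter are
inert, and so is the deterministic evaluation after `#`. A diverging search is a `τ`-loop at
`s_{o,μ}` up to branching bisimilarity.

Partial recursive functions are evaluated by a Turing machine whose alphabet does not depend on the
function, and the control of the simulating machine is finite. So the auxiliary symbols depend
neither on the persistent Turing machine nor on `D`: words over `D` are encoded by numbers.
-/

/-! ### Composition of branching bisimulations -/

namespace LTS

variable {A : Type*}

section BranchingBisimulation

variable {T₁ : LTS A} {T₂ : LTS A} {T₃ : LTS A} {R : T₁.State → T₂.State → Prop}
  {S : T₂.State → T₃.State → Prop}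

theorem IsBranchingBisimulation.symm (hR : IsBranchingBisimulation T₁ T₂ R) :
    IsBranchingBisimulation T₂ T₁ (fun s t => R t s) where
  step_left s₁ s₂ := hR.step_right s₂ s₁
  step_right s₁ s₂ := hR.step_left s₂ s₁
  final_left s₁ s₂ := hR.final_right s₂ s₁
  final_right s₁ s₂ := hR.final_left s₂ s₁

theorem IsBranchingBisimulation.taus_left (hR : IsBranchingBisimulation T₁ T₂ R)
    {s₁ t₁ : T₁.State} (hst : T₁.taus s₁ t₁) {s₂ : T₂.State} (h : R s₁ s₂) :
    ∃ t₂, T₂.taus s₂ t₂ ∧ R t₁ t₂ := by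
  induction hst with
  | refl => exact ⟨s₂, .refl, h⟩
  | tail _ hstep ih =>
    obtain ⟨u₂, hu, hRu⟩ := ih
    obtain ⟨v₂, t₂, hv, hstep' | ⟨_, rfl⟩, _, hRt⟩ := hR.step_left _ _ hRu _ _ hstep
    · exact ⟨t₂, (hu.trans hv).tail hstep', hRt⟩
    · exact ⟨v₂, hu.trans hv, hRt⟩

theorem IsBranchingBisimulation.comp_step_left (hR : IsBranchingBisimulation T₁ T₂ R)
    (hS : IsBranchingBisimulation T₂ T₃ S) {s₁ t₁ : T₁.State} {s₃ : T₃.State}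
    (h : Comp R S s₁ s₃) {a : Option A} (ht : T₁.step s₁ a t₁) :
    ∃ u₃ t₃, T₃.taus s₃ u₃ ∧ T₃.optStep u₃ a t₃ ∧ Comp R S s₁ u₃ ∧ Comp R S t₁ t₃ := by
  obtain ⟨s₂, h₁, h₂⟩ := h
  obtain ⟨u₂, t₂, hu, hopt, hRu, hRt⟩ := hR.step_left _ _ h₁ _ _ ht
  obtain ⟨v₃, hv, hSv⟩ := hS.taus_left hu h₂
  rcases hopt with hstep | ⟨rfl, rfl⟩
  · obtain ⟨u₃, t₃, hu₃, hopt₃, hSu, hSt⟩ := hS.step_left _ _ hSv _ _ hstep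
    exact ⟨u₃, t₃, hv.trans hu₃, hopt₃, ⟨u₂, hRu, hSu⟩, ⟨t₂, hRt, hSt⟩⟩
  · exact ⟨v₃, v₃, hv, .inr ⟨rfl, rfl⟩, ⟨u₂, hRu, hSv⟩, ⟨u₂, hRt, hSv⟩⟩

theorem IsBranchingBisimulation.comp_final_left (hR : IsBranchingBisimulation T₁ T₂ R)
    (hS : IsBranchingBisimulation T₂ T₃ S) {s₁ : T₁.State} {s₃ : T₃.State}
    (h : Comp R S s₁ s₃) (hf : s₁ ∈ T₁.final) :
    ∃ t₃, T₃.taus s₃ t₃ ∧ Comp R S s₁ t₃ ∧ t₃ ∈ T₃.final := by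
  obtain ⟨s₂, h₁, h₂⟩ := h
  obtain ⟨t₂, ht₂, hRt, hf₂⟩ := hR.final_left _ _ h₁ hf
  obtain ⟨v₃, hv, hSv⟩ := hS.taus_left ht₂ h₂
  obtain ⟨t₃, ht₃, hSt, hf₃⟩ := hS.final_left _ _ hSv hf₂
  exact ⟨t₃, hv.trans ht₃, ⟨t₂, hRt, hSt⟩, hf₃⟩

theorem IsBranchingBisimulation.comp (hR : IsBranchingBisimulation T₁ T₂ R)
    (hS : IsBranchingBisimulation T₂ T₃ S) : IsBranchingBisimulation T₁ T₃ (Comp R S) := by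
  have comp_swap (s t) : Comp (fun a b => S b a) (fun a b => R b a) t s ↔ Comp R S s t :=
    exists_congr fun _ => and_comm
  refine ⟨fun _ _ h _ _ => hR.comp_step_left hS h, fun s₁ s₃ h a t₃ ht => ?_,
    fun _ _ h => hR.comp_final_left hS h, fun s₁ s₃ h hf => ?_⟩
  · simpa only [comp_swap] using hS.symm.comp_step_left hR.symm ((comp_swap _ _).2 h) ht
  · simpa only [comp_swap] using hS.symm.comp_final_left hR.symm ((comp_swap _ _).2 h) hf

theorem BranchingBisimilar.trans (h₁ : BranchingBisimilar T₁ T₂)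
    (h₂ : BranchingBisimilar T₂ T₃) : BranchingBisimilar T₁ T₃ := by
  obtain ⟨R, hR, hR₀⟩ := h₁
  obtain ⟨S, hS, hS₀⟩ := h₂
  exact ⟨Comp R S, hR.comp hS, T₂.start, hR₀, hS₀⟩

/-- `R` is a strong bisimulation from `T₁` to `T₂`. -/
structure IsBisimulation (T₁ : LTS A) (T₂ : LTS A) (R : T₁.State → T₂.State → Prop) : Prop where
  step_left : ∀ s₁ s₂, R s₁ s₂ → ∀ a t₁, T₁.step s₁ a t₁ → ∃ t₂, T₂.step s₂ a t₂ ∧ R t₁ t₂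
  step_right : ∀ s₁ s₂, R s₁ s₂ → ∀ a t₂, T₂.step s₂ a t₂ → ∃ t₁, T₁.step s₁ a t₁ ∧ R t₁ t₂
  final_iff : ∀ s₁ s₂, R s₁ s₂ → (s₁ ∈ T₁.final ↔ s₂ ∈ T₂.final)

theorem IsBisimulation.isBranchingBisimulation (hR : IsBisimulation T₁ T₂ R) :
    IsBranchingBisimulation T₁ T₂ R where
  step_left s₁ s₂ h a t₁ ht :=
    have ⟨t₂, ht₂, hRt⟩ := hR.step_left s₁ s₂ h a t₁ ht
    ⟨s₂, t₂, .refl, .inl ht₂, h, hRt⟩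
  step_right s₁ s₂ h a t₂ ht :=
    have ⟨t₁, ht₁, hRt⟩ := hR.step_right s₁ s₂ h a t₂ ht
    ⟨s₁, t₁, .refl, .inl ht₁, h, hRt⟩
  final_left s₁ s₂ h hf := ⟨s₂, .refl, h, (hR.final_iff s₁ s₂ h).1 hf⟩
  final_right s₁ s₂ h hf := ⟨s₁, .refl, h, (hR.final_iff s₁ s₂ h).2 hf⟩

theorem IsBisimulation.branchingBisimilar (hR : IsBisimulation T₁ T₂ R)
    (h₀ : R T₁.start T₂.start) : BranchingBisimilar T₁ T₂ :=
  ⟨R, hR.isBranchingBisimulation, h₀⟩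

end BranchingBisimulation

section DeterministicComputation

variable {C : Type*} (next : C → Option C) (offer : C → Option A → C → Prop) (c₀ : C)

/-- The transition system in which `next` is performed silently and, once `next` has halted, one
of the transitions in `offer` is taken. -/
def ofNext : LTS A where
  State := C
  step c a c' := a = none ∧ next c = some c' ∨ next c = none ∧ offer c a c'
  start := c₀
  final := ∅

/-- The variant of `LTS.ofNext` in which a whole halting computation of `next` and the transition
from `offer` that follows it form a single step. -/
def ofEval : LTS A where
  State := C
  step c a c' := ∃ d ∈ StateTransition.eval next c, offer d a c'
  start := c₀
  final := ∅

theorem taus_ofNext_of_reaches {c d : C} (h : StateTransition.Reaches next c d) :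
    (ofNext next offer c₀).taus c d :=
  ReflTransGen.mono (fun _ _ hnext => Or.inl ⟨rfl, hnext⟩) _ _ h

/-- Deterministic internal steps are inert, so a configuration may be related to all those that it
reaches. -/
theorem ofEval_branchingBisimilar_ofNext :
    BranchingBisimilar (ofEval next offer c₀) (ofNext next offer c₀) := by
  refine ⟨StateTransition.Reaches next, ⟨?_, ?_, fun _ _ _ h => h.elim, fun _ _ _ h => h.elim⟩,
    .refl⟩
  · rintro c c' hc a t ⟨d, hd, ht⟩
    have hcd := (StateTransition.mem_eval.1 hd).1
    obtain ⟨hc'd, hnext⟩ :=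
      StateTransition.mem_eval.1 (StateTransition.reaches_eval hc ▸ hd)
    exact ⟨d, t, taus_ofNext_of_reaches next offer c₀ hc'd, .inl (.inr ⟨hnext, ht⟩), hcd, .refl⟩
  · rintro c c' hc a t (⟨rfl, hnext⟩ | ⟨hnext, ht⟩)
    · exact ⟨c, c, .refl, .inr ⟨rfl, rfl⟩, hc, hc.tail hnext⟩
    · exact ⟨c, t, .refl, .inl ⟨c', StateTransition.mem_eval.2 ⟨hc, hnext⟩, ht⟩, hc, .refl⟩

end DeterministicComputation

end LTS

/-! ### Interactive Turing machines and reactive Turing machines -/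

open Turing

section TapeMachine

variable {A Q Γ E : Type*} [Inhabited Γ]

/-- The transition system of a tape machine, in the format of `RTM.toLTS` but with a possibly
infinite control and an arbitrary tape alphabet. -/
def tapeLTS (q₀ : Q) (tr : Q → Γ → Option A → Γ → Dir → Q → Prop) : LTS A where
  State := Q × Tape Γ
  step c a c' := ∃ e m, tr c.1 c.2.head a e m c'.1 ∧ c'.2 = (c.2.write e).move m
  start := (q₀, default)
  final := ∅

theorem tape_map_default {Γ' : Type*} [Inhabited Γ'] (f : PointedMap Γ Γ') :
    (default : Tape Γ).map f = default := by
  change Tape.mk (f default) (ListBlank.map f (.mk [])) (ListBlank.map f (.mk [])) =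
    Tape.mk default (.mk []) (.mk [])
  simp

theorem exists_rtm_of_tapeLTS {q₀ : Q} {tr : Q → Γ → Option A → Γ → Dir → Q → Prop} {S : Set Q}
    (hS : S.Finite) (h₀ : q₀ ∈ S)
    (hclosed : ∀ q d a e m q', tr q d a e m q' → q ∈ S → q' ∈ S)
    {i : PointedMap Γ (Option E)} (hi : Function.Injective i) :
    ∃ N : RTM A E, LTS.BranchingBisimilar (tapeLTS q₀ tr) N.toLTS := by
  have := hS.to_subtype
  let e := Finite.equivFin S
  let N : RTM A E :=
    { State := Fin (Nat.card S)
      finite_state := inferInstance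
      start := e ⟨q₀, h₀⟩
      final := ∅
      trans := fun s d a x m t => ∃ d' x', d = i d' ∧ x = i x' ∧
        tr (e.symm s) d' a x' m (e.symm t) }
  have he (q : Q) (hq : q ∈ S) : q = e.symm (e ⟨q, hq⟩) := by rw [e.symm_apply_apply]
  have hR : LTS.IsBisimulation (tapeLTS q₀ tr) N.toLTS
      fun c c' => ∃ s T, c = (↑(e.symm s), T) ∧ c' = (s, T.map i) := by
    refine ⟨?_, ?_, fun _ _ _ => Iff.rfl⟩
    · rintro _ _ ⟨s, T, rfl, rfl⟩ a ⟨q, _⟩ ⟨x, m, htr, rfl⟩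
      have hq := he q (hclosed _ _ _ _ _ _ htr (e.symm s).2)
      exact ⟨(e ⟨q, _⟩, ((T.write x).move m).map i),
        ⟨i x, m, ⟨T.head, x, rfl, rfl, hq ▸ htr⟩, by simp [Tape.map_move, Tape.map_write]⟩,
        _, _, Prod.ext hq rfl, rfl⟩
    · rintro _ _ ⟨s, T, rfl, rfl⟩ a ⟨t, _⟩ ⟨_, m, ⟨d, x, hd, rfl, htr⟩, rfl⟩
      obtain rfl : T.head = d := hi hd
      exact ⟨(e.symm t, (T.write x).move m), ⟨x, m, htr, rfl⟩, t, _, rfl,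
        Prod.ext rfl (by simp [Tape.map_move, Tape.map_write])⟩
  exact ⟨N, hR.branchingBisimilar
    ⟨e ⟨q₀, h₀⟩, default, Prod.ext (he q₀ h₀) rfl, Prod.ext rfl (tape_map_default i).symm⟩⟩

end TapeMachine

/-- An interactive Turing machine: it computes like `tm` and, where `tm` halts, takes one of the
transitions in `offer`, which depend on the control state and on the symbol under the head and
leave the tape as it is. -/
structure InteractiveMachine (A Γ Λ : Type*) [Inhabited Λ] where
  tm : TM0.Machine Γ Λ
  offer : Λ → Γ → Option A → Λ → Prop

namespace InteractiveMachine

variable {A Γ Λ E : Type*} [Inhabited Λ] [Inhabited Γ]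

/-- The transitions that a machine offers in its configurations. -/
def Offers (M : InteractiveMachine A Γ Λ) (c : TM0.Cfg Γ Λ) (a : Option A) (c' : TM0.Cfg Γ Λ) :
    Prop :=
  M.offer c.q c.Tape.head a c'.q ∧ c'.Tape = c.Tape

/-- The transition system of an interactive machine, started on the blank tape. Each transition is
a halting computation followed by an offered transition. -/
def toLTS (M : InteractiveMachine A Γ Λ) : LTS A :=
  .ofEval (TM0.step M.tm) M.Offers ⟨default, default⟩

/-- The transition system of the single steps of an interactive machine. -/
def stepLTS (M : InteractiveMachine A Γ Λ) : LTS A :=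
  .ofNext (TM0.step M.tm) M.Offers ⟨default, default⟩

/-- An interactive machine as a machine that writes and moves in each step. Instead of staying in
place it moves to the right, and to the left in the next step: the control states marked with
`true` are those in which this move to the left is due. -/
inductive Trans (M : InteractiveMachine A Γ Λ) :
    Bool × Λ → Γ → Option A → Γ → Dir → Bool × Λ → Prop
  | move {q d q' m} : M.tm q d = some (q', .move m) → M.Trans (false, q) d none d m (false, q')
  | write {q d q' e} : M.tm q d = some (q', .write e) →
      M.Trans (false, q) d none e .right (true, q')
  | offer {q d a q'} : M.tm q d = none → M.offer q d a q' →
      M.Trans (false, q) d a d .right (true, q')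
  | back {q d} : M.Trans (true, q) d none d .left (false, q)

/-- The configurations of the machine `InteractiveMachine.Trans` that correspond to `c`. -/
inductive Delayed (c : TM0.Cfg Γ Λ) : (Bool × Λ) × Tape Γ → Prop
  | here : Delayed c ((false, c.q), c.Tape)
  | right : Delayed c ((true, c.q), c.Tape.move .right)

variable {M : InteractiveMachine A Γ Λ}

theorem Delayed.taus {c : TM0.Cfg Γ Λ} {c'} (h : Delayed c c') :
    (tapeLTS (false, default) M.Trans).taus c' ((false, c.q), c.Tape) := by
  cases h with
  | here => exact .refl
  | right => exact .single ⟨_, _, .back, by simp⟩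

theorem exists_step_tapeLTS {c t : TM0.Cfg Γ Λ} {a : Option A} (h : M.stepLTS.step c a t) :
    ∃ t', (tapeLTS (false, default) M.Trans).step ((false, c.q), c.Tape) a t' ∧ Delayed t t' := by
  obtain ⟨q, T⟩ := c
  obtain ⟨q', T'⟩ := t
  rcases h with ⟨rfl, h⟩ | ⟨h, ho, hT⟩
  · obtain ⟨⟨p, s⟩, htm, hp⟩ := Option.map_eq_some_iff.1 h
    cases s <;> cases hp
    · exact ⟨_, ⟨_, _, .move htm, rfl⟩, by simpa using Delayed.here ..⟩
    · exact ⟨_, ⟨_, _, .write htm, rfl⟩, .right⟩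
  · obtain rfl : T' = T := hT
    exact ⟨_, ⟨_, _, .offer (Option.map_eq_none_iff.1 h) ho, rfl⟩, by simpa using Delayed.right ..⟩

theorem exists_step_stepLTS {c : TM0.Cfg Γ Λ} {a : Option A} {t'}
    (h : (tapeLTS (false, default) M.Trans).step ((false, c.q), c.Tape) a t') :
    ∃ t, M.stepLTS.step c a t ∧ Delayed t t' := by
  obtain ⟨q, T⟩ := c
  obtain ⟨p, T'⟩ := t'
  obtain ⟨e, m, h, rfl⟩ := h
  cases h with
  | @move _ _ q' _ htm =>
    exact ⟨⟨q', T.move m⟩, .inl ⟨rfl, by simp_all [TM0.step]⟩, by simpa using Delayed.here ..⟩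
  | @write _ _ q' _ htm =>
    exact ⟨⟨q', T.write e⟩, .inl ⟨rfl, by simp_all [TM0.step]⟩, .right⟩
  | @offer _ _ _ q' htm ho =>
    exact ⟨⟨q', T⟩, .inr ⟨by simp_all [TM0.step], ho, rfl⟩, by simpa using Delayed.right ..⟩

variable (M) in
theorem stepLTS_branchingBisimilar_tapeLTS :
    LTS.BranchingBisimilar M.stepLTS (tapeLTS (false, default) M.Trans) := by
  refine ⟨Delayed, ⟨?_, ?_, fun _ _ _ h => h.elim, fun _ _ _ h => h.elim⟩, .here⟩
  · intro c c' h a t ht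
    obtain ⟨t', ht', hR⟩ := exists_step_tapeLTS ht
    exact ⟨_, t', h.taus, .inl ht', .here, hR⟩
  · rintro c _ (_ | _) a t' ht'
    · obtain ⟨t, ht, hR⟩ := exists_step_stepLTS ht'
      exact ⟨c, t, .refl, .inl ht, .here, hR⟩
    · obtain ⟨p, T'⟩ := t'
      obtain ⟨e, m, h, rfl⟩ := ht'
      cases h
      exact ⟨c, c, .refl, .inr ⟨rfl, rfl⟩, .right, by simpa using Delayed.here ..⟩

variable (M) in
theorem exists_rtm {S : Set Λ} (hS : S.Finite) (h₀ : default ∈ S)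
    (htm : ∀ q d q' s, M.tm q d = some (q', s) → q ∈ S → q' ∈ S)
    (hoffer : ∀ q d a q', M.offer q d a q' → q ∈ S → q' ∈ S)
    {i : PointedMap Γ (Option E)} (hi : Function.Injective i) :
    ∃ N : RTM A E, LTS.BranchingBisimilar M.toLTS N.toLTS := by
  have hclosed (q d a e m q') (h : M.Trans q d a e m q') : q.2 ∈ S → q'.2 ∈ S := by
    cases h with
    | move h => exact htm _ _ _ _ h
    | write h => exact htm _ _ _ _ h
    | offer _ h => exact hoffer _ _ _ _ h
    | back => exact id
  obtain ⟨N, hN⟩ := exists_rtm_of_tapeLTS (S := Set.univ ×ˢ S) (Set.finite_univ.prod hS)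
    (q₀ := (false, default)) ⟨trivial, h₀⟩
    (fun q d a e m q' h hq => ⟨trivial, hclosed q d a e m q' h hq.2⟩) hi
  exact ⟨N, (LTS.ofEval_branchingBisimilar_ofNext _ _ _).trans
    (M.stepLTS_branchingBisimilar_tapeLTS.trans hN)⟩

end InteractiveMachine

/-! ### Related partial values -/

section PartialValues

/-- Lifting of a relation to partial values: one is defined if and only if the other is, and their
values are then related. -/
def PartRel {α β : Type*} (r : α → β → Prop) (p : Part α) (p' : Part β) : Prop :=
  (p.Dom ↔ p'.Dom) ∧ ∀ a ∈ p, ∀ b ∈ p', r a b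

variable {α β γ δ : Type*} {r : α → β → Prop} {p : Part α} {p' : Part β}

theorem PartRel.exists_left (h : PartRel r p p') {b : β} (hb : b ∈ p') : ∃ a ∈ p, r a b := by
  obtain ⟨a, ha⟩ := Part.dom_iff_mem.1 (h.1.2 (Part.dom_iff_mem.2 ⟨b, hb⟩))
  exact ⟨a, ha, h.2 a ha b hb⟩

theorem PartRel.exists_right (h : PartRel r p p') {a : α} (ha : a ∈ p) : ∃ b ∈ p', r a b := by
  obtain ⟨b, hb⟩ := Part.dom_iff_mem.1 (h.1.1 (Part.dom_iff_mem.2 ⟨a, ha⟩))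
  exact ⟨b, hb, h.2 a ha b hb⟩

theorem PartRel.comp (h : PartRel r p p') {s : β → γ → Prop} {p'' : Part γ}
    (h' : PartRel s p' p'') : PartRel (Comp r s) p p'' := by
  refine ⟨h.1.trans h'.1, fun a ha c hc => ?_⟩
  obtain ⟨b, hb, hs⟩ := h'.exists_left hc
  exact ⟨b, h.2 a ha b hb, hs⟩

theorem partRel_map_left {f : γ → α} {q : Part γ} :
    PartRel r (q.map f) p' ↔ PartRel (fun c b => r (f c) b) q p' := by
  simp [PartRel, Part.mem_map_iff]

theorem PartRel.bind_right (h : PartRel r p p') {s : α → γ → Prop} {g : β → Part γ}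
    (hg : ∀ a, ∀ b ∈ p', r a b → ∃ c ∈ g b, s a c) : PartRel s p (p'.bind g) := by
  refine ⟨⟨fun hp => ?_, fun hp' => h.1.2 hp'.1⟩, fun a ha c hc => ?_⟩
  · obtain ⟨b, hb, hr⟩ := h.exists_right (Part.get_mem hp)
    obtain ⟨c, hc, -⟩ := hg _ b hb hr
    exact Part.dom_iff_mem.2 ⟨c, Part.mem_bind hb hc⟩
  · obtain ⟨b, hb, hcb⟩ := Part.mem_bind_iff.1 hc
    obtain ⟨c', hc', hs⟩ := hg a b hb (h.2 a ha b hb)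
    exact Part.mem_unique hc' hcb ▸ hs

end PartialValues

section StateTransition

variable {α β : Type*} {f : α → Option α} {g : β → Option β}

theorem partRel_eval_of_respects {r : α → β → Prop} (h : StateTransition.Respects f g r) {a : α}
    {b : β} (hab : r a b) : PartRel r (StateTransition.eval f a) (StateTransition.eval g b) := by
  refine ⟨(StateTransition.tr_eval_dom h hab).symm, fun a' ha' b' hb' => ?_⟩
  obtain ⟨b'', hr, hb''⟩ := StateTransition.tr_eval h hab ha'
  exact Part.mem_unique hb'' hb' ▸ hr

/-- A subprogram embedded by `φ` is run first, and the surrounding program takes over where it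
halts. -/
theorem eval_eq_bind_of_embedding {φ : α → β}
    (hφ : ∀ a a', f a = some a' → g (φ a) = some (φ a')) (a : α) :
    StateTransition.eval g (φ a) =
      (StateTransition.eval f a).bind fun d => StateTransition.eval g (φ d) := by
  ext b
  rw [Part.mem_bind_iff]
  constructor
  · intro hb
    refine StateTransition.evalInduction (C := fun c => ∀ a, φ a = c →
      ∃ d ∈ StateTransition.eval f a, b ∈ StateTransition.eval g (φ d)) hb ?_ a rfl
    rintro _ hb ih a rfl
    cases hfa : f a with
    | none => exact ⟨a, StateTransition.mem_eval.2 ⟨.refl, hfa⟩, hb⟩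
    | some a' =>
      rw [StateTransition.reaches_eval (.single hfa)]
      exact ih _ (hφ a a' hfa) a' rfl
  · rintro ⟨d, hd, hb⟩
    have : StateTransition.Reaches g (φ a) (φ d) :=
      ReflTransGen.lift φ hφ _ _ (StateTransition.mem_eval.1 hd).1
    rwa [StateTransition.reaches_eval this]

end StateTransition

/-! ### Partial recursive functions on tape machines -/

section StackMachine

/-- A program for finitely many stacks, in the format of `Turing.TM2`. -/
abbrev StackMachine {K : Type*} (Γ : K → Type*) (Λ σ : Type*) : Type _ :=
  Λ → TM2.Stmt Γ Λ σ

namespace StackMachine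

variable {K : Type*} {Γ : K → Type*} {Λ σ : Type*}

/-- The tape `T`, with its head in the bottom cells, holds the stacks `S`. -/
def Represents (T : Tape (TM2to1.Γ' K Γ)) (S : ∀ k, List (Γ k)) : Prop :=
  ∃ L : ListBlank (∀ k, Option (Γ k)),
    (∀ k, L.map (proj k) = ListBlank.mk ((S k).map some).reverse) ∧
      T = Tape.mk' ∅ (TM2to1.addBottom L)

theorem Represents.head_snd {T : Tape (TM2to1.Γ' K Γ)} {S : ∀ k, List (Γ k)}
    (h : Represents T S) (k : K) : T.head.2 k = (S k).getLast? := by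
  obtain ⟨L, hL, rfl⟩ := h
  have hbottom : (Tape.mk' ∅ (TM2to1.addBottom L)).head.2 = L.head := by
    simpa using TM2to1.addBottom_nth_snd L 0
  have hhead := congrArg ListBlank.head (hL k)
  rw [ListBlank.head_map, ListBlank.head_mk, ← List.map_reverse] at hhead
  rw [hbottom, List.getLast?_eq_head?_reverse, show L.head k = _ from hhead]
  cases (S k).reverse <;> rfl

/-- The tape symbol that marks the bottom of empty stacks. -/
def bottom : TM2to1.Γ' K Γ := (true, fun _ => none)

theorem represents_empty :
    Represents ((default : Tape (TM2to1.Γ' K Γ)).write bottom) fun _ => [] :=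
  ⟨∅, fun _ => rfl, rfl⟩

variable [DecidableEq K] [Inhabited Λ] [Inhabited σ] (M : StackMachine Γ Λ σ)

/-- The control states of `StackMachine.toTM0`. -/
abbrev TM0State : Type _ := TM1to0.Λ' (TM2to1.tr M)

/-- The one-tape machine that simulates a stack machine. -/
abbrev toTM0 : TM0.Machine (TM2to1.Γ' K Γ) M.TM0State :=
  TM1to0.tr (TM2to1.tr M)

/-- The control state in which `StackMachine.toTM0` starts to simulate the label `l` of `M` with
the value `v` of the internal variable. -/
def entry (l : Option Λ) (v : σ) : M.TM0State :=
  ((l.map TM2to1.Λ'.normal).map (TM2to1.tr M), v)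

theorem partRel_eval (l : Option Λ) (v : σ) {S : ∀ k, List (Γ k)} {T : Tape (TM2to1.Γ' K Γ)}
    (hT : Represents T S) :
    PartRel (fun b c => Represents c.Tape b.stk)
      (StateTransition.eval (TM2.step M) ⟨l, v, S⟩)
      (StateTransition.eval (TM0.step M.toTM0) ⟨M.entry l v, T⟩) := by
  obtain ⟨L, hL, rfl⟩ := hT
  obtain ⟨hdom, h⟩ := (partRel_eval_of_respects (TM2to1.tr_respects M) (.mk L hL)).comp
    (partRel_eval_of_respects (TM1to0.tr_respects (TM2to1.tr M)) rfl)
  refine ⟨hdom, fun b hb c hc => ?_⟩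
  obtain ⟨_, ⟨L', hL'⟩, rfl⟩ := h b hb c hc
  exact ⟨L', hL', rfl⟩

theorem exists_finite_closed [Finite σ] {S : Finset Λ} (hS : TM2.Supports M S) :
    ∃ S₀ : Set M.TM0State, S₀.Finite ∧ (∀ l ∈ S, ∀ v, M.entry (some l) v ∈ S₀) ∧
      ∀ q a q' s, M.toTM0 q a = some (q', s) → q ∈ S₀ → q' ∈ S₀ := by
  classical
  have := Fintype.ofFinite σ
  have hsupp := TM1to0.tr_supports (TM2to1.tr M) (TM2to1.tr_supports M hS)
  refine ⟨_, Finset.finite_toSet _, fun l hl v => ?_, fun q a q' s => hsupp.2⟩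
  refine Finset.mem_product.2 ⟨Finset.some_mem_insertNone.2 ?_, Finset.mem_univ v⟩
  exact Finset.mem_biUnion.2 ⟨.normal l,
    Finset.mem_biUnion.2 ⟨l, hl, Finset.mem_insert_self _ _⟩, TM1.stmts₁_self⟩

end StackMachine

end StackMachine

section PartrecStackMachine

open PartrecToTM2

theorem finite_partrecToTM2_stack : Finite K' :=
  .of_surjective (fun i : Fin 4 => ![K'.main, .rev, .aux, .stack] i) fun k =>
    match k with
    | .main => ⟨0, rfl⟩
    | .rev => ⟨1, rfl⟩
    | .aux => ⟨2, rfl⟩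
    | .stack => ⟨3, rfl⟩

/-- The machine `Turing.PartrecToTM2.tr`, which evaluates codes of partial recursive functions. -/
abbrev codeMachine : StackMachine (fun _ : K' => Γ') Λ' (Option Γ') := tr

/-- The stacks between two evaluations: the list `v` is stored in reverse on the stack `rev`, so
that its first symbol is in the bottom cell, where the tape machine can read it. -/
def stored (v : List ℕ) : K' → List Γ' := K'.elim [] (trList v).reverse [] []

/-- The program that moves the stored list back to the stack `main` and evaluates `c`. -/
def launch (c : ToPartrec.Code) : Λ' := .move (fun _ => false) .rev .main (trNormal c .halt)

/-- The program that stores the list on the stack `main`. -/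
def store : Λ' := .move (fun _ => false) .main .rev (.ret .halt)

theorem eval_launch (c : ToPartrec.Code) (v : List ℕ) (s : Option Γ') :
    StateTransition.eval (TM2.step tr) ⟨some (launch c), s, stored v⟩ = (c.eval v).map halt := by
  have h := move_ok (p := fun _ => false) (k₁ := .rev) (k₂ := .main) (q := trNormal c .halt)
    (s := s) (S := stored v) (by decide) (splitAtPred_false _)
  rw [launch, StateTransition.reaches_eval h.to_reflTransGen]
  simpa [init, stored] using tr_eval c v

theorem eval_store (v : List ℕ) (s : Option Γ') :
    StateTransition.eval (TM2.step tr) ⟨some store, s, (halt v).stk⟩ =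
      .some ⟨none, none, stored v⟩ := by
  have h := move_ok (p := fun _ => false) (k₁ := .main) (k₂ := .rev) (q := .ret .halt)
    (s := s) (S := (halt v).stk) (by decide) (splitAtPred_false _)
  rw [store, StateTransition.reaches_eval h.to_reflTransGen]
  refine Part.eq_some_iff.2 (StateTransition.mem_eval.2 ⟨.single ?_, rfl⟩)
  simp [TM2.step, TM2.stepAux, halt, stored]

theorem getLast?_stored_singleton (n : ℕ) :
    (stored [n] .rev).getLast? = some Γ'.bit1 ↔ n.bodd = true := by
  obtain ⟨x, rfl⟩ : ∃ x : Num, (x : ℕ) = n := ⟨n, Num.to_of_nat n⟩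
  simp only [stored, K'.elim_rev, List.getLast?_reverse, trList, trNat, Num.of_to_nat]
  cases x with
  | zero => simp [trNum]
  | pos p => cases p <;> simp [trNum, trPosNum, Nat.bodd_add]

theorem exists_supports_launch_store {Q : Type*} [Finite Q] (code : Q → ToPartrec.Code) :
    ∃ S : Finset Λ', TM2.Supports tr S ∧ (∀ q, launch (code q) ∈ S) ∧ store ∈ S := by
  classical
  have := Fintype.ofFinite Q
  let S : Finset Λ' := {.ret .halt, store} ∪
    Finset.univ.biUnion fun q => insert (launch (code q)) (codeSupp (code q) .halt)
  have hret : .ret .halt ∈ S := by simp [S]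
  have hstore : store ∈ S := by simp [S]
  have hsub (q) : insert (launch (code q)) (codeSupp (code q) .halt) ⊆ S :=
    (Finset.subset_biUnion_of_mem (fun q => insert (launch (code q)) (codeSupp (code q) .halt))
      (Finset.mem_univ q)).trans Finset.subset_union_right
  have hlaunch (q) : launch (code q) ∈ S := hsub q (Finset.mem_insert_self _ _)
  have hnormal (q) : trNormal (code q) .halt ∈ S :=
    hsub q (Finset.mem_insert_of_mem (codeSupp_self _ _ (trStmts₁_self _)))
  refine ⟨S, ⟨hret, fun l hl => ?_⟩, hlaunch, hstore⟩
  simp only [S, Finset.mem_union, Finset.mem_insert, Finset.mem_singleton, Finset.mem_biUnion,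
    Finset.mem_univ, true_and] at hl
  rcases hl with (rfl | rfl) | ⟨q, rfl | hl⟩
  · trivial
  · simpa [store, TM2.SupportsStmt] using ⟨hret, hstore⟩
  · simpa [launch, TM2.SupportsStmt] using ⟨hnormal q, hlaunch q⟩
  · exact codeSupp_supports ((Finset.subset_insert _ _).trans (hsub q)) l hl

theorem exists_code_of_partrec {f : ℕ →. ℕ} (hf : Partrec f) :
    ∃ c : ToPartrec.Code, ∀ v, c.eval v = (f v.headI).map fun m => [m] := by
  obtain ⟨c, hc⟩ := ToPartrec.Code.exists_code (Nat.Partrec'.part_iff₁.2 hf)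
  refine ⟨c.comp .head, fun v => ?_⟩
  simp only [ToPartrec.Code.comp_eval, ToPartrec.Code.head_eval]
  exact (Part.bind_some _ _).trans (hc (v.headI ::ᵥ .nil))

end PartrecStackMachine

/-! ### Control programs -/

/-- A program that alternates between evaluating the partial function `run q` of its control state
`q` on its data and taking one of the transitions in `offer`. The value of `run q` consists of the
new data and a flag, on which the offered transitions depend. -/
structure ControlProgram (A Q σ : Type*) where
  run : Q → σ →. σ × Bool
  offer : Q → Bool → Option A → Q → Prop

/-- The tape alphabet of `StackMachine.toTM0` for `codeMachine`. -/
abbrev TapeSymbol : Type := TM2to1.Γ' PartrecToTM2.K' fun _ => PartrecToTM2.Γ'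

instance : Finite TapeSymbol :=
  have := finite_partrecToTM2_stack
  inferInstanceAs (Finite (Bool × (PartrecToTM2.K' → Option PartrecToTM2.Γ')))

namespace ControlProgram

variable {A Q σ : Type*} (P : ControlProgram A Q σ)

/-- The transition system of a control program. Each transition is a terminating evaluation
followed by an offered transition. -/
def toLTS (q₀ : Q) (x₀ : σ) : LTS A where
  State := Q × σ
  step c a c' := ∃ b, (c'.2, b) ∈ P.run c.1 c.2 ∧ P.offer c.1 b a c'.1
  start := (q₀, x₀)
  final := ∅

section Machine

open PartrecToTM2

/-- The control states of `ControlProgram.machine`. In `none` the tape is to be initialized; in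
`some (q, b, s)` the control state of the program is `q` and `codeMachine` is in the state `s`,
where `b` tells whether it evaluates a code or already stores the value. -/
abbrev MachineState (Q : Type*) : Type _ := Option (Q × Bool × codeMachine.TM0State)

variable (code : Q → ToPartrec.Code) (q₀ : Q)

/-- The state in which the machine starts to evaluate `code q`. -/
def launchState (q : Q) : MachineState Q :=
  some (q, false, codeMachine.entry (some (launch (code q))) none)

/-- The machine that evaluates the codes of a control program and stores their values. -/
def evalMachine : TM0.Machine TapeSymbol (MachineState Q)
  | none, _ => some (launchState code q₀, .write StackMachine.bottom)
  | some (q, b, s), d =>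
    match codeMachine.toTM0 s d, b with
    | some (s', m), _ => some (some (q, b, s'), m)
    | none, false => some (some (q, true, codeMachine.entry (some store) none), .write d)
    | none, true => none

/-- The interactive machine that runs a control program, where `code` consists of codes for the
functions `P.run q`. The flag is the least significant bit of the stored value. -/
def machine : InteractiveMachine A TapeSymbol (MachineState Q) where
  tm := evalMachine code q₀
  offer p d a p' := ∃ q s q', p = some (q, true, s) ∧ p' = launchState code q' ∧
    P.offer q (d.2 .rev = some Γ'.bit1) a q'

variable {code q₀}

theorem step_evalMachine_of_step (q : Q) (b : Bool) {c c' : TM0.Cfg TapeSymbol codeMachine.TM0State}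
    (h : TM0.step codeMachine.toTM0 c = some c') :
    TM0.step (evalMachine code q₀) ⟨some (q, b, c.q), c.Tape⟩ =
      some ⟨some (q, b, c'.q), c'.Tape⟩ := by
  obtain ⟨⟨s, m⟩, hs, rfl⟩ := Option.map_eq_some_iff.1 h
  simp only [TM0.step, evalMachine, hs]
  cases m <;> rfl

theorem eval_evalMachine (q : Q) (b : Bool) (s : codeMachine.TM0State) (T : Tape TapeSymbol) :
    StateTransition.eval (TM0.step (evalMachine code q₀)) ⟨some (q, b, s), T⟩ =
      (StateTransition.eval (TM0.step codeMachine.toTM0) ⟨s, T⟩).bind fun c =>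
        StateTransition.eval (TM0.step (evalMachine code q₀)) ⟨some (q, b, c.q), c.Tape⟩ :=
  eval_eq_bind_of_embedding
    (φ := fun c : TM0.Cfg _ _ => (⟨some (q, b, c.q), c.Tape⟩ : TM0.Cfg _ _))
    (fun _ _ => step_evalMachine_of_step q b) ⟨s, T⟩

theorem toTM0_eq_none_of_mem_eval {c c' : TM0.Cfg TapeSymbol codeMachine.TM0State}
    (h : c' ∈ StateTransition.eval (TM0.step codeMachine.toTM0) c) :
    codeMachine.toTM0 c'.q c'.Tape.head = none :=
  Option.map_eq_none_iff.1 (StateTransition.mem_eval.1 h).2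

/-- The machine has halted in the control state `q` with the list `v` on its tape. -/
def IsHalted (q : Q) (v : List ℕ) (c : TM0.Cfg TapeSymbol (MachineState Q)) : Prop :=
  ∃ s T, c = ⟨some (q, true, s), T⟩ ∧ StackMachine.Represents T (stored v)

theorem exists_isHalted_of_represents_halt (q : Q) {v : List ℕ} {T : Tape TapeSymbol}
    (hT : StackMachine.Represents T (halt v).stk) :
    ∃ c ∈ StateTransition.eval (TM0.step (evalMachine code q₀))
        ⟨some (q, true, codeMachine.entry (some store) none), T⟩, IsHalted q v c := by
  have hstore := codeMachine.partRel_eval (some store) none hT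
  rw [eval_store] at hstore
  obtain ⟨c, hc, hrep⟩ := hstore.exists_right (Part.mem_some _)
  rw [eval_evalMachine]
  refine ⟨⟨some (q, true, c.q), c.Tape⟩, Part.mem_bind hc (StateTransition.mem_eval.2 ⟨.refl, ?_⟩),
    c.q, c.Tape, rfl, hrep⟩
  simp only [TM0.step, evalMachine, toTM0_eq_none_of_mem_eval hc, Option.map_none]

theorem partRel_eval_launchState (q : Q) {v : List ℕ} {T : Tape TapeSymbol}
    (hT : StackMachine.Represents T (stored v)) :
    PartRel (IsHalted q) ((code q).eval v)
      (StateTransition.eval (TM0.step (evalMachine code q₀)) ⟨launchState code q, T⟩) := by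
  have hlaunch := codeMachine.partRel_eval (some (launch (code q))) none hT
  rw [eval_launch] at hlaunch
  rw [launchState, eval_evalMachine]
  refine (partRel_map_left.1 hlaunch).bind_right fun v' c hc hrep => ?_
  have hstep : TM0.step (evalMachine code q₀) ⟨some (q, false, c.q), c.Tape⟩ =
      some ⟨some (q, true, codeMachine.entry (some store) none), c.Tape⟩ := by
    simp only [TM0.step, evalMachine, toTM0_eq_none_of_mem_eval hc, Option.map_some,
      Tape.write_self]
  rw [StateTransition.reaches_eval (.single hstep)]
  exact exists_isHalted_of_represents_halt q hrep

theorem partRel_eval_default :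
    PartRel (IsHalted q₀) ((code q₀).eval [])
      (StateTransition.eval (TM0.step (evalMachine code q₀)) default) := by
  have hstep : TM0.step (evalMachine code q₀) default =
    some ⟨launchState code q₀, (default : Tape TapeSymbol).write StackMachine.bottom⟩ := rfl
  rw [StateTransition.reaches_eval (.single hstep)]
  have hempty : stored [] = fun _ => [] := funext fun k => by cases k <;> rfl
  exact partRel_eval_launchState q₀ (hempty ▸ StackMachine.represents_empty)

variable {P} {enc : σ → ℕ} {dec : ℕ → σ}

theorem branchingBisimilar_machine (hdec : ∀ b y, dec (Nat.bit b (enc y)) = y)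
    (hcode : ∀ q v, (code q).eval v =
      (P.run q (dec v.headI)).map fun yb => [Nat.bit yb.2 (enc yb.1)]) :
    LTS.BranchingBisimilar (P.toLTS q₀ (dec 0)) (P.machine code q₀).toLTS := by
  have hR : LTS.IsBisimulation (P.toLTS q₀ (dec 0)) (P.machine code q₀).toLTS fun s c =>
      PartRel (fun yb => IsHalted s.1 [Nat.bit yb.2 (enc yb.1)]) (P.run s.1 s.2)
        (StateTransition.eval (TM0.step (evalMachine code q₀)) c) := by
    have hlaunch (q y b) (T : Tape TapeSymbol)
        (hT : StackMachine.Represents T (stored [Nat.bit b (enc y)])) :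
        PartRel (fun yb => IsHalted q [Nat.bit yb.2 (enc yb.1)]) (P.run q y)
          (StateTransition.eval (TM0.step (evalMachine code q₀)) ⟨launchState code q, T⟩) := by
      simpa [hcode, partRel_map_left, hdec] using
        partRel_eval_launchState (code := code) (q₀ := q₀) q hT
    have hflag (y b) (T : Tape TapeSymbol)
        (hT : StackMachine.Represents T (stored [Nat.bit b (enc y)])) :
        decide (T.head.2 .rev = some Γ'.bit1) = b := by
      simp only [hT.head_snd, getLast?_stored_singleton, Nat.bodd_bit, Bool.decide_eq_true]
    refine ⟨?_, ?_, fun _ _ _ => Iff.rfl⟩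
    · rintro ⟨q, x⟩ c hc a ⟨q', y⟩ ⟨b, hy, hoffer⟩
      obtain ⟨_, hd, s, T, rfl, hT⟩ := hc.exists_right hy
      refine ⟨⟨launchState code q', T⟩, ⟨_, hd, ⟨q, s, q', rfl, rfl, ?_⟩, rfl⟩, hlaunch q' y b T hT⟩
      rwa [hflag y b T hT]
    · rintro ⟨q, x⟩ c hc a ⟨_, T'⟩ ⟨d, hd, ⟨q₁, s, q', hq₁, rfl, hoffer⟩, hT'⟩
      obtain ⟨⟨y, b⟩, hy, s', _, rfl, hT⟩ := hc.exists_left hd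
      cases hq₁
      cases hT'
      exact ⟨(q', y), ⟨b, hy, by rwa [hflag y b T' hT] at hoffer⟩, hlaunch q' y b T' hT⟩
  have hstart := partRel_eval_default (code := code) (q₀ := q₀)
  rw [hcode] at hstart
  exact hR.branchingBisimilar (partRel_map_left.1 hstart)

variable (code q₀) in
theorem exists_finite_closed_evalMachine [Finite Q] :
    ∃ S : Set (MachineState Q), S.Finite ∧ none ∈ S ∧ (∀ q, launchState code q ∈ S) ∧
      ∀ p d p' m, evalMachine code q₀ p d = some (p', m) → p ∈ S → p' ∈ S := by
  obtain ⟨L, hL, hlaunch, hstore⟩ := exists_supports_launch_store code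
  obtain ⟨S, hS, hentry, hclosed⟩ := codeMachine.exists_finite_closed hL
  refine ⟨insert none (some '' (Set.univ ×ˢ Set.univ ×ˢ S)),
    ((Set.finite_univ.prod (Set.finite_univ.prod hS)).image _).insert _, by simp,
    fun q => .inr ⟨_, ⟨trivial, trivial, hentry _ (hlaunch q) _⟩, rfl⟩, ?_⟩
  rintro (_ | ⟨q, b, s⟩) d p' m hm hp
  · cases hm
    exact .inr ⟨_, ⟨trivial, trivial, hentry _ (hlaunch q₀) _⟩, rfl⟩
  · have hs : s ∈ S := by simpa using hp
    rcases hs' : codeMachine.toTM0 s d with _ | ⟨s', m'⟩ <;> cases b <;>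
      simp only [evalMachine, hs', Option.some.injEq, Prod.mk.injEq, reduceCtorEq] at hm
    · exact .inr ⟨_, ⟨trivial, trivial, hentry _ hstore _⟩, hm.1⟩
    all_goals exact .inr ⟨_, ⟨trivial, trivial, hclosed _ _ _ _ hs' hs⟩, hm.1⟩

end Machine

theorem exists_rtm [Finite Q] [Primcodable σ] (hP : ∀ q, Partrec (P.run q)) (q₀ : Q) (x₀ : σ)
    {E : Type*} {i : PointedMap TapeSymbol (Option E)} (hi : Function.Injective i) :
    ∃ N : RTM A E, LTS.BranchingBisimilar (P.toLTS q₀ x₀) N.toLTS := by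
  let enc (y : σ) : ℕ := Encodable.encode (some y)
  let dec (n : ℕ) : σ := ((Encodable.decode (α := Option σ) n.div2).bind id).getD x₀
  have hdec (b y) : dec (Nat.bit b (enc y)) = y := by
    simp only [dec, enc, Nat.div2_bit, Encodable.encodek, Option.bind_some, id, Option.getD_some]
  have hcomp (q) : Partrec fun n => (P.run q (dec n)).map fun yb => Nat.bit yb.2 (enc yb.1) := by
    have hcdec : Computable dec := Computable.option_getD
      (Computable.option_bind (Computable.decode.comp Primrec.nat_div2.to_comp) Computable.snd)
      (Computable.const x₀)
    have hdouble : Computable fun x : ℕ × σ × Bool => 2 * enc x.2.1 :=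
      Primrec.nat_double.to_comp.comp (Computable.encode.comp
        (Computable.option_some.comp (Computable.fst.comp Computable.snd)))
    have hbit : Computable₂ fun (_ : ℕ) (x : σ × Bool) => Nat.bit x.2 (enc x.1) :=
      (Computable.cond (Computable.snd.comp Computable.snd) (Computable.succ.comp hdouble)
        hdouble).of_eq fun ⟨_, _, b⟩ => by cases b <;> rfl
    exact ((hP q).comp hcdec).map hbit
  choose code hcode using fun q => exists_code_of_partrec (hcomp q)
  obtain ⟨S, hS, h₀, hlaunch, hclosed⟩ := exists_finite_closed_evalMachine code q₀
  obtain ⟨N, hN⟩ := (P.machine code q₀).exists_rtm hS h₀ hclosed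
    (fun _ _ _ _ ⟨_, _, q', _, h, _⟩ _ => h ▸ hlaunch q') hi
  refine ⟨N, LTS.BranchingBisimilar.trans ?_ hN⟩
  exact branchingBisimilar_machine hdec fun q v => by rw [hcode, Part.map_map]; rfl

end ControlProgram

/-! ### Finitely branching computations -/

namespace ComputationTree

variable {C : Type*} (succ : C → List C)

/-- The nodes at depth `n` of the tree of all computations that start in `c`. -/
def level (c : C) (n : ℕ) : List C := (fun l => l.flatMap succ)^[n] [c]

theorem level_succ (c : C) (n : ℕ) : level succ c (n + 1) = (level succ c n).flatMap succ :=
  Function.iterate_succ_apply' _ n _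

theorem level_succ' (c : C) (n : ℕ) :
    level succ c (n + 1) = (succ c).flatMap fun d => level succ d n := by
  induction n with
  | zero => simp [level]
  | succ n ih => rw [level_succ, ih, List.flatMap_assoc]; simp only [level_succ]

variable {succ} {c : C}

theorem reflTransGen_of_mem_level {n : ℕ} {d : C} (h : d ∈ level succ c n) :
    ReflTransGen (fun c d => d ∈ succ c) c d := by
  induction n generalizing d with
  | zero => rw [List.mem_singleton.1 h]
  | succ n ih =>
    rw [level_succ] at h
    obtain ⟨e, he, hd⟩ := List.mem_flatMap.1 h
    exact (ih he).tail hd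

theorem exists_mem_level {d : C} (h : ReflTransGen (fun c d => d ∈ succ c) c d) :
    ∃ n, d ∈ level succ c n := by
  induction h with
  | refl => exact ⟨0, List.mem_singleton_self c⟩
  | tail _ hd ih =>
    obtain ⟨n, hn⟩ := ih
    exact ⟨n + 1, level_succ succ c n ▸ List.mem_flatMap.2 ⟨_, hn, hd⟩⟩

theorem level_eq_nil_of_le {m n : ℕ} (hmn : m ≤ n) (h : level succ c m = []) :
    level succ c n = [] := by
  induction n, hmn using Nat.le_induction with
  | base => exact h
  | succ n _ ih => rw [level_succ, ih, List.flatMap_nil]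

theorem exists_mem_succ_forall_level_ne_nil (h : ∀ n, level succ c n ≠ []) :
    ∃ d ∈ succ c, ∀ n, level succ d n ≠ [] := by
  by_contra! hne
  have hfinite : ∀ᶠ n in Filter.atTop, ∀ d ∈ {d | d ∈ succ c}, level succ d n = [] := by
    refine (Filter.eventually_all_finite (List.finite_toSet _)).2 fun d hd => ?_
    obtain ⟨m, hm⟩ := hne d hd
    exact Filter.eventually_atTop.2 ⟨m, fun n hn => level_eq_nil_of_le hn hm⟩
  obtain ⟨n, hn⟩ := hfinite.exists
  exact h (n + 1) (level_succ' succ c n ▸ List.flatMap_eq_nil_iff.2 hn)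

/-- **König's lemma** for a finitely branching tree. -/
theorem exists_path_of_forall_level_ne_nil (h : ∀ n, level succ c n ≠ []) :
    ∃ f : ℕ → C, f 0 = c ∧ ∀ n, f (n + 1) ∈ succ (f n) := by
  choose next hnext using fun s : {c // ∀ n, level succ c n ≠ []} =>
    exists_mem_succ_forall_level_ne_nil s.2
  let path : ℕ → {c // ∀ n, level succ c n ≠ []} :=
    Nat.rec ⟨c, h⟩ fun _ s => ⟨next s, (hnext s).2⟩
  exact ⟨fun n => (path n).1, rfl, fun n => (hnext (path n)).1⟩

theorem level_ne_nil_of_path {f : ℕ → C} (hf : ∀ n, f (n + 1) ∈ succ (f n)) (n : ℕ) :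
    level succ (f 0) n ≠ [] := by
  suffices f n ∈ level succ (f 0) n from List.ne_nil_of_mem this
  induction n with
  | zero => exact List.mem_singleton_self _
  | succ n ih => exact level_succ succ (f 0) n ▸ List.mem_flatMap.2 ⟨_, ih, hf n⟩

theorem exists_mem_level_succ_eq_nil {n : ℕ} (h : level succ c n = []) :
    ∃ m, ∃ d ∈ level succ c m, succ d = [] := by
  induction n with
  | zero => exact absurd h (List.cons_ne_nil _ _)
  | succ n ih =>
    cases hl : level succ c n with
    | nil => exact ih hl
    | cons d l =>
      rw [level_succ] at h
      have hd : d ∈ level succ c n := hl ▸ List.mem_cons_self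
      exact ⟨n, d, hd, List.flatMap_eq_nil_iff.1 h d hd⟩

variable (succ) in
/-- The leaf whose depth and position are encoded by the first component of `e`, if there is such a
leaf. The second component of `e` is padding, so that each guess has arbitrarily large codes. -/
def guess (c : C) (e : ℕ) : Option C :=
  (level succ c e.unpair.1.unpair.1)[e.unpair.1.unpair.2]?.bind fun d =>
    bif (succ d).isEmpty then some d else none

theorem of_guess_eq_some {e : ℕ} {d : C} (h : guess succ c e = some d) :
    ReflTransGen (fun c d => d ∈ succ c) c d ∧ succ d = [] := by
  obtain ⟨d', hd', h⟩ := Option.bind_eq_some_iff.1 h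
  cases hs : (succ d').isEmpty with
  | false => simp [hs] at h
  | true =>
    obtain rfl : d' = d := by simpa [hs] using h
    exact ⟨reflTransGen_of_mem_level (List.mem_of_getElem? hd'), List.isEmpty_iff.1 hs⟩

theorem exists_ge_guess_eq_some {n : ℕ} {d : C} (h : d ∈ level succ c n) (hd : succ d = [])
    (e₀ : ℕ) : ∃ e ≥ e₀, guess succ c e = some d := by
  obtain ⟨i, hi⟩ := List.mem_iff_getElem?.1 h
  exact ⟨Nat.pair (Nat.pair n i) e₀, Nat.right_le_pair _ _, by simp [guess, hi, hd]⟩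

variable (succ c) in
theorem exists_ge_guess_eq_none (e₀ : ℕ) : ∃ e ≥ e₀, guess succ c e = none :=
  ⟨Nat.pair (Nat.pair 0 1) e₀, Nat.right_le_pair _ _, by simp [guess, level]⟩

variable (succ) in
/-- A leaf of the tree of computations that start in `x.1`: the one that is guessed by `x.2`, if
there is one. Otherwise the tree is searched for some leaf if it is finite, and the search diverges
if the tree is infinite. -/
def outcome (x : C × ℕ) : Part C :=
  bif (guess succ x.1 x.2).isSome then Part.ofOption (guess succ x.1 x.2)
  else (Nat.rfind fun n => Part.some (level succ x.1 n).isEmpty).bind fun _ =>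
    Nat.rfindOpt (guess succ x.1)

theorem mem_outcome_of_guess {d : C} {e : ℕ} (h : guess succ c e = some d) :
    d ∈ outcome succ (c, e) := by
  simp [outcome, h]

theorem outcome_of_guess_eq_none {e : ℕ} (h : guess succ c e = none) :
    outcome succ (c, e) = (Nat.rfind fun n => Part.some (level succ c n).isEmpty).bind fun _ =>
      Nat.rfindOpt (guess succ c) := by
  simp [outcome, h]

theorem of_mem_outcome {e : ℕ} {d : C} (h : d ∈ outcome succ (c, e)) :
    ReflTransGen (fun c d => d ∈ succ c) c d ∧ succ d = [] := by
  suffices ∃ e, guess succ c e = some d from this.elim fun _ => of_guess_eq_some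
  cases hg : guess succ c e with
  | some d' =>
    obtain rfl := Part.mem_unique h (mem_outcome_of_guess hg)
    exact ⟨e, hg⟩
  | none =>
    rw [outcome_of_guess_eq_none hg] at h
    obtain ⟨_, _, h⟩ := Part.mem_bind_iff.1 h
    exact Nat.rfindOpt_spec h

theorem exists_ge_mem_outcome {d : C} (h : ReflTransGen (fun c d => d ∈ succ c) c d)
    (hd : succ d = []) (e₀ : ℕ) : ∃ e ≥ e₀, d ∈ outcome succ (c, e) := by
  obtain ⟨n, hn⟩ := exists_mem_level h
  obtain ⟨e, he, hg⟩ := exists_ge_guess_eq_some hn hd e₀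
  exact ⟨e, he, mem_outcome_of_guess hg⟩

theorem exists_path_of_not_outcome_dom {e : ℕ} (h : ¬ (outcome succ (c, e)).Dom) :
    ∃ f : ℕ → C, f 0 = c ∧ ∀ n, f (n + 1) ∈ succ (f n) := by
  refine exists_path_of_forall_level_ne_nil fun n hn => h ?_
  cases hg : guess succ c e with
  | some d => exact Part.dom_iff_mem.2 ⟨d, mem_outcome_of_guess hg⟩
  | none =>
    obtain ⟨m, d, hd, hs⟩ := exists_mem_level_succ_eq_nil hn
    obtain ⟨e', -, he'⟩ := exists_ge_guess_eq_some hd hs 0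
    have hsearch : (Nat.rfind fun n => Part.some (level succ c n).isEmpty).Dom :=
      Nat.rfind_dom.2 ⟨n, by simp [hn], fun _ => trivial⟩
    rw [outcome_of_guess_eq_none hg]
    exact ⟨hsearch, Nat.rfindOpt_dom.2 ⟨e', d, he'⟩⟩

theorem exists_ge_not_outcome_dom {f : ℕ → C} (hf : ∀ n, f (n + 1) ∈ succ (f n)) (e₀ : ℕ) :
    ∃ e ≥ e₀, ¬ (outcome succ (f 0, e)).Dom := by
  obtain ⟨e, he, hg⟩ := exists_ge_guess_eq_none succ (f 0) e₀
  refine ⟨e, he, ?_⟩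
  rw [outcome_of_guess_eq_none hg]
  rintro ⟨hsearch, -⟩
  obtain ⟨n, hn, -⟩ := Nat.rfind_dom.1 hsearch
  exact level_ne_nil_of_path hf n (by simpa using hn)

section Computability

variable [Primcodable C]

theorem primrec_list_isEmpty : Primrec (List.isEmpty : List C → Bool) :=
  (Primrec.list_casesOn Primrec.id (Primrec.const true) (Primrec.const false).to₂).of_eq
    fun l => by cases l <;> rfl

theorem primrec_level (hs : Primrec succ) : Primrec₂ (level succ) :=
  Primrec.nat_iterate Primrec.snd (Primrec.list_cons.comp Primrec.fst (Primrec.const []))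
    (Primrec.list_flatMap Primrec.snd (hs.comp Primrec.snd).to₂).to₂

theorem primrec_guess (hs : Primrec succ) : Primrec₂ (guess succ) := by
  have hindex : Primrec fun x : C × ℕ => x.2.unpair.1.unpair :=
    Primrec.unpair.comp (Primrec.fst.comp (Primrec.unpair.comp Primrec.snd))
  refine Primrec.option_bind (Primrec.list_getElem?.comp ((primrec_level hs).comp Primrec.fst
    (Primrec.fst.comp hindex)) (Primrec.snd.comp hindex)) ?_
  exact Primrec.cond (primrec_list_isEmpty.comp (hs.comp Primrec.snd))
    (Primrec.option_some.comp Primrec.snd) (Primrec.const none)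

theorem partrec_outcome (hs : Primrec succ) : Partrec (outcome succ) := by
  have hg := primrec_guess hs
  refine Partrec.cond (Primrec.option_isSome.comp hg).to_comp hg.to_comp.ofOption
    (Partrec.bind (Partrec.rfind ?_) ?_)
  · exact (primrec_list_isEmpty.comp ((primrec_level hs).comp (Primrec.fst.comp Primrec.fst)
      Primrec.snd)).to_comp.partrec
  · exact (Partrec.rfindOpt hg.to_comp).comp (Computable.fst.comp Computable.fst)

end Computability

end ComputationTree

/-! ### Computable simulation of persistent Turing machines -/

/-- The encoding of a finite type by an initial segment of the natural numbers. -/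
@[reducible]
noncomputable def primcodableOfFinite (α : Type*) [Finite α] : Primcodable α :=
  Primcodable.ofEquiv (Fin (Nat.card α)) (Finite.equivFin α)

namespace HeadMove

instance : Finite HeadMove :=
  Set.finite_univ_iff.1 <| Set.Finite.subset (Set.toFinite {left, stay, right}) fun m _ => by
    cases m <;> simp

noncomputable instance : Primcodable HeadMove := primcodableOfFinite _

theorem primrec_apply : Primrec₂ HeadMove.apply := by
  have hincrement : Primrec fun m : HeadMove => m.apply 0 := Primrec.dom_finite _
  have hdecrement : Primrec fun m : HeadMove => 1 - m.apply 1 := Primrec.dom_finite _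
  refine (Primrec.nat_sub.comp (Primrec.nat_add.comp Primrec.snd (hincrement.comp Primrec.fst))
    (hdecrement.comp Primrec.fst)).of_eq ?_
  rintro ⟨_ | _ | _, n⟩ <;> rfl

end HeadMove

namespace PTM

variable {D : Type u}

theorem HalfTape.Contains.length_le {t : HalfTape D} {w w' : List D} (h : t.Contains w)
    (h' : t.Contains w') : w'.length ≤ w.length := by
  by_contra! hlt
  have hblank : t.cell w.length = none := (h _ le_rfl).trans (List.getElem?_eq_none le_rfl)
  rw [h' _ hlt.le, List.getElem?_eq_none_iff] at hblank
  exact hlt.not_ge hblank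

theorem HalfTape.Contains.unique {t : HalfTape D} {w w' : List D} (h : t.Contains w)
    (h' : t.Contains w') : w = w' := by
  have hlength : w.length = w'.length := le_antisymm (h'.length_le h) (h.length_le h')
  refine List.ext_getElem?_iff.2 fun n => ?_
  rcases le_or_gt n w.length with hn | hn
  · rw [← h n hn, h' n (hlength ▸ hn)]
  · rw [List.getElem?_eq_none hn.le, List.getElem?_eq_none (hlength ▸ hn.le)]

/-- A semi-infinite tape on which almost all cells are blank, given by an initial segment and the
head position. -/
abbrev ListTape (D : Type u) : Type u := List (Option D) × ℕ

namespace ListTape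

/-- The semi-infinite tape that is represented by a list. -/
def toHalfTape (t : ListTape D) : HalfTape D := ⟨fun n => t.1.getD n none, t.2⟩

/-- The symbol under the head. -/
def read (t : ListTape D) : Option D := t.1.getD t.2 none

/-- The tape after writing `b` in the cell under the head. -/
def write (t : ListTape D) (b : Option D) : ListTape D :=
  ((List.range (t.1.length + t.2 + 1)).map fun n => if n = t.2 then b else t.1.getD n none, t.2)

/-- The tape after a head move. -/
def move (t : ListTape D) (m : HeadMove) : ListTape D := (t.1, m.apply t.2)

/-- The word at the beginning of the tape, up to the first blank. -/
def content (t : ListTape D) : List D := (t.1.takeWhile Option.isSome).reduceOption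

theorem toHalfTape_map_some (w : List D) : toHalfTape (w.map some, 0) = HalfTape.ofWord w := by
  rw [toHalfTape, HalfTape.ofWord, HalfTape.mk.injEq]
  refine ⟨funext fun n => ?_, rfl⟩
  rw [List.getD_eq_getElem?_getD, List.getElem?_map]
  cases w[n]? <;> rfl

theorem toHalfTape_write (t : ListTape D) (b : Option D) :
    (t.write b).toHalfTape = t.toHalfTape.write b := by
  obtain ⟨l, h⟩ := t
  rw [toHalfTape, HalfTape.write, HalfTape.mk.injEq]
  refine ⟨funext fun n => ?_, rfl⟩
  rcases eq_or_ne n h with rfl | hne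
  · simp [write, toHalfTape]
  · rcases lt_or_ge n (l.length + h + 1) with hn | hn
    · simp [write, toHalfTape, hn, hne]
    · have hl : l.length ≤ n := by omega
      have hrange : (List.range (l.length + h + 1))[n]? = none :=
        List.getElem?_eq_none (List.length_range.trans_le hn)
      simp [write, toHalfTape, hrange, hne, hl]

theorem toHalfTape_write_read (t : ListTape D) :
    t.toHalfTape.write t.read = t.toHalfTape := by
  simp [HalfTape.write, toHalfTape, read]

theorem toHalfTape_move (t : ListTape D) (m : HeadMove) :
    (t.move m).toHalfTape = t.toHalfTape.move m := rfl

theorem contains_content (t : ListTape D) : t.toHalfTape.Contains t.content := by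
  obtain ⟨l, h⟩ := t
  induction l with
  | nil => simp [HalfTape.Contains, content, toHalfTape]
  | cons x l ih =>
    cases x with
    | none => simp [HalfTape.Contains, content, toHalfTape]
    | some d =>
      have hcontent : content (some d :: l, h) = d :: content (l, h) := rfl
      rw [hcontent]
      rintro (_ | n) hn
      · rfl
      · exact ih n (Nat.le_of_succ_le_succ hn)

section Primrec

variable [Primcodable D]

theorem primrec_read : Primrec (read : ListTape D → Option D) :=
  (Primrec.list_getD none).comp Primrec.fst Primrec.snd

theorem primrec_write : Primrec₂ (write : ListTape D → Option D → ListTape D) := by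
  have hlist : Primrec fun x : (ListTape D × Option D) × ℕ => x.1.1.1 :=
    Primrec.fst.comp (Primrec.fst.comp Primrec.fst)
  have hhead : Primrec fun x : ListTape D × Option D => x.1.2 := Primrec.snd.comp Primrec.fst
  have hlength : Primrec fun x : ListTape D × Option D => x.1.1.length + x.1.2 + 1 :=
    Primrec.succ.comp
      (Primrec.nat_add.comp (Primrec.list_length.comp (Primrec.fst.comp Primrec.fst)) hhead)
  exact (Primrec.list_map (Primrec.list_range.comp hlength)
    (Primrec.ite (Primrec.eq.comp Primrec.snd (hhead.comp Primrec.fst))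
      (Primrec.snd.comp Primrec.fst) ((Primrec.list_getD none).comp hlist Primrec.snd)).to₂).pair
    hhead

theorem primrec_move : Primrec₂ (move : ListTape D → HeadMove → ListTape D) :=
  (Primrec.fst.comp Primrec.fst).pair
    (HeadMove.primrec_apply.comp Primrec.snd (Primrec.snd.comp Primrec.fst))

theorem primrec_content : Primrec (content : ListTape D → List D) :=
  Primrec.listFilterMap ((Primrec.list_takeWhile Primrec.option_isSome).comp Primrec.fst)
    Primrec.snd

end Primrec

end ListTape

variable (M : PTM.{u, v} D)

instance : Finite M.State := M.finite_state

/-- What a persistent Turing machine may choose in one step. As in `PTM.trans`, the value `none` of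
`output` means that nothing is written on the output tape. -/
structure Choice where
  state : M.State
  work : Option D
  output : Option (Option D)
  moveInput : HeadMove
  moveWork : HeadMove
  moveOutput : HeadMove

instance [Finite D] : Finite M.Choice :=
  Finite.of_injective
    (fun k => (k.state, k.work, k.output, k.moveInput, k.moveWork, k.moveOutput))
    (by rintro ⟨⟩ ⟨⟩ h; simpa using h)

noncomputable instance [Finite D] : Primcodable M.Choice := primcodableOfFinite _

/-- Configurations with the state and the input, work and output tapes given by lists. -/
abbrev ListConfig : Type max u v := M.State × ListTape D × ListTape D × ListTape D

/-- The representation by lists of the configuration in which a macrostep starts. -/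
def listStart (w wi : List D) : M.ListConfig :=
  (M.start, (wi.map some, 0), (w.map some, 0), ([], 0))

variable {M}

/-- The configuration that is represented by lists. -/
def ListConfig.toConfig (c : M.ListConfig) : M.Config :=
  ⟨c.1, c.2.1.toHalfTape, c.2.2.1.toHalfTape, c.2.2.2.toHalfTape⟩

theorem toConfig_listStart (w wi : List D) :
    (M.listStart w wi).toConfig = M.startConfig w wi := by
  rw [startConfig, ← ListTape.toHalfTape_map_some, ← ListTape.toHalfTape_map_some,
    ← ListTape.toHalfTape_map_some]
  rfl

/-- The configuration after the step that is determined by a choice. -/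
def ListConfig.next (c : M.ListConfig) (k : M.Choice) : M.ListConfig :=
  (k.state, c.2.1.move k.moveInput, (c.2.2.1.write k.work).move k.moveWork,
    (c.2.2.2.write (k.output.getD c.2.2.2.read)).move k.moveOutput)

theorem ListConfig.toConfig_next (c : M.ListConfig) (k : M.Choice) :
    (c.next k).toConfig =
      { state := k.state
        input := c.toConfig.input.move k.moveInput
        work := (c.toConfig.work.write k.work).move k.moveWork
        output := (match k.output with
          | none => c.toConfig.output
          | some y => c.toConfig.output.write y).move k.moveOutput } := by
  cases h : k.output with
  | none =>
    simp only [ListConfig.toConfig, ListConfig.next, h, Option.getD_none,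
      ListTape.toHalfTape_move, ListTape.toHalfTape_write, ListTape.toHalfTape_write_read]
  | some y =>
    simp only [ListConfig.toConfig, ListConfig.next, h, Option.getD_some,
      ListTape.toHalfTape_move, ListTape.toHalfTape_write]

section Finite

variable [Finite D]

variable (M) in
/-- The choices that are allowed in the state `q` when the symbols `a` and `b` are read. -/
noncomputable def enabled (q : M.State) (a b : Option D) : List M.Choice :=
  (Set.toFinite {k : M.Choice | M.trans q a b k.state k.work k.output k.moveInput k.moveWork
    k.moveOutput}).toFinset.toList

/-- The configurations that can be reached in one step. -/
noncomputable def ListConfig.successors (c : M.ListConfig) : List M.ListConfig :=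
  (M.enabled c.1 c.2.1.read c.2.2.1.read).map c.next

theorem step_toConfig_iff {c : M.ListConfig} {c' : M.Config} :
    M.Step c.toConfig c' ↔ ∃ d ∈ c.successors, d.toConfig = c' := by
  simp only [ListConfig.successors, enabled, List.mem_map, Finset.mem_toList,
    Set.Finite.mem_toFinset, Set.mem_ofPred_eq, exists_exists_and_eq_and, ListConfig.toConfig_next]
  constructor
  · rintro ⟨b, x, mi, mw, mo, h, hi, hw, ho⟩
    obtain ⟨q', i', w', o'⟩ := c'
    dsimp only at hi hw ho
    subst hi hw ho
    exact ⟨⟨q', b, x, mi, mw, mo⟩, h, rfl⟩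
  · rintro ⟨k, h, rfl⟩
    exact ⟨k.work, k.output, k.moveInput, k.moveWork, k.moveOutput, h, rfl, rfl, rfl⟩

theorem halted_toConfig_iff {c : M.ListConfig} : M.Halted c.toConfig ↔ c.successors = [] := by
  simp only [Halted, step_toConfig_iff, List.eq_nil_iff_forall_not_mem]
  exact ⟨fun h d hd => h d.toConfig ⟨d, hd, rfl⟩, fun h _ ⟨d, hd, _⟩ => h d hd⟩

theorem reflTransGen_step_toConfig_iff {c : M.ListConfig} {c' : M.Config} :
    ReflTransGen M.Step c.toConfig c' ↔
      ∃ d, ReflTransGen (fun c d => d ∈ c.successors) c d ∧ d.toConfig = c' := by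
  constructor
  · intro h
    induction h with
    | refl => exact ⟨c, .refl, rfl⟩
    | tail _ h ih =>
      obtain ⟨d, hd, rfl⟩ := ih
      obtain ⟨d', hd', rfl⟩ := step_toConfig_iff.1 h
      exact ⟨d', hd.tail hd', rfl⟩
  · rintro ⟨d, hd, rfl⟩
    exact ReflTransGen.lift ListConfig.toConfig
      (fun _ d h => step_toConfig_iff.2 ⟨d, h, rfl⟩) _ _ hd

theorem exists_path_successors {c₀ : M.ListConfig} {c : ℕ → M.Config} (h₀ : c 0 = c₀.toConfig)
    (hc : ∀ n, M.Step (c n) (c (n + 1))) :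
    ∃ f : ℕ → M.ListConfig, f 0 = c₀ ∧ ∀ n, f (n + 1) ∈ (f n).successors := by
  have hlift (n : ℕ) (d : {d : M.ListConfig // d.toConfig = c n}) :
      ∃ d' : {d : M.ListConfig // d.toConfig = c (n + 1)}, d'.1 ∈ d.1.successors := by
    obtain ⟨d', hd', h⟩ := step_toConfig_iff.1 (d.2.symm ▸ hc n)
    exact ⟨⟨d', h⟩, hd'⟩
  choose next hnext using hlift
  let path (n : ℕ) : {d : M.ListConfig // d.toConfig = c n} := Nat.rec ⟨c₀, h₀.symm⟩ next n
  exact ⟨fun n => (path n).1, rfl, fun n => hnext n (path n)⟩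

variable (M) in
/-- The evaluation of a macrostep. The arguments are the contents of the work and the input tape and
a guess for `ComputationTree.outcome`; the values are the final contents of the work and the output
tape. -/
noncomputable def simulate (x : List D × List D × ℕ) : Part (List D × List D) :=
  (ComputationTree.outcome ListConfig.successors (M.listStart x.1 x.2.1, x.2.2)).map fun c =>
    (c.2.2.1.content, c.2.2.2.content)

theorem macrostep_of_mem_simulate {w wi : List D} {e : ℕ} {r : List D × List D}
    (h : r ∈ M.simulate (w, wi, e)) : M.Macrostep (.word w) wi (.word r.2) (.word r.1) := by
  obtain ⟨c, hc, rfl⟩ := (Part.mem_map_iff _).1 h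
  obtain ⟨hreach, hleaf⟩ := ComputationTree.of_mem_outcome hc
  refine .halt w wi _ _ c.toConfig ?_ (halted_toConfig_iff.2 hleaf)
    (ListTape.contains_content _) (ListTape.contains_content _)
  exact toConfig_listStart w wi ▸ reflTransGen_step_toConfig_iff.2 ⟨c, hreach, rfl⟩

theorem macrostep_of_not_simulate_dom {w wi : List D} {e : ℕ} (h : ¬ (M.simulate (w, wi, e)).Dom) :
    M.Macrostep (.word w) wi .mu .infinity := by
  obtain ⟨f, hf₀, hf⟩ := ComputationTree.exists_path_of_not_outcome_dom (mt Part.dom_iff_mem.1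
    fun ⟨c, hc⟩ => h (Part.dom_iff_mem.2 ⟨_, Part.mem_map _ hc⟩))
  refine .diverge w wi (fun n => (f n).toConfig) ?_ fun n => step_toConfig_iff.2 ⟨_, hf n, rfl⟩
  rw [hf₀, toConfig_listStart]

theorem exists_ge_simulate_of_macrostep {w wi : List D} {wo : Output D} {t : MacroState D}
    (h : M.Macrostep (.word w) wi wo t) (e₀ : ℕ) : ∃ e ≥ e₀,
      (∃ r ∈ M.simulate (w, wi, e), wo = .word r.2 ∧ t = .word r.1) ∨
      (¬ (M.simulate (w, wi, e)).Dom ∧ wo = .mu ∧ t = .infinity) := by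
  cases h with
  | halt _ _ wo w' c hc hhalted hw ho =>
    rw [← toConfig_listStart] at hc
    obtain ⟨d, hd, rfl⟩ := reflTransGen_step_toConfig_iff.1 hc
    obtain ⟨e, he, hmem⟩ :=
      ComputationTree.exists_ge_mem_outcome hd (halted_toConfig_iff.1 hhalted) e₀
    refine ⟨e, he, .inl ⟨_, Part.mem_map _ hmem, ?_, ?_⟩⟩
    · exact congrArg Output.word (ho.unique (ListTape.contains_content _))
    · exact congrArg MacroState.word (hw.unique (ListTape.contains_content _))
  | diverge _ _ c h₀ hc =>
    obtain ⟨f, hf₀, hf⟩ := exists_path_successors (h₀.trans (toConfig_listStart w wi).symm) hc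
    obtain ⟨e, he, hdom⟩ := ComputationTree.exists_ge_not_outcome_dom hf e₀
    exact ⟨e, he, .inr ⟨by simpa [simulate, hf₀] using hdom, rfl, rfl⟩⟩

variable [Primcodable D]

theorem ListConfig.primrec_next [Primcodable M.State] :
    Primrec₂ (ListConfig.next : M.ListConfig → M.Choice → M.ListConfig) := by
  have hk : Primrec fun x : M.ListConfig × M.Choice => x.2 := Primrec.snd
  have htapes : Primrec fun x : M.ListConfig × M.Choice => x.1.2 := Primrec.snd.comp Primrec.fst
  have hinput := Primrec.fst.comp htapes
  have hwork := Primrec.fst.comp (Primrec.snd.comp htapes)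
  have houtput := Primrec.snd.comp (Primrec.snd.comp htapes)
  have hstate := (Primrec.dom_finite (Choice.state (M := M))).comp hk
  have hmoveInput := (Primrec.dom_finite (Choice.moveInput (M := M))).comp hk
  have hmoveWork := (Primrec.dom_finite (Choice.moveWork (M := M))).comp hk
  have hmoveOutput := (Primrec.dom_finite (Choice.moveOutput (M := M))).comp hk
  refine hstate.pair ((ListTape.primrec_move.comp hinput hmoveInput).pair
    ((ListTape.primrec_move.comp ?_ hmoveWork).pair
      (ListTape.primrec_move.comp ?_ hmoveOutput)))
  · exact ListTape.primrec_write.comp hwork ((Primrec.dom_finite Choice.work).comp hk)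
  · exact ListTape.primrec_write.comp houtput
      (Primrec.option_getD.comp ((Primrec.dom_finite Choice.output).comp hk)
        (ListTape.primrec_read.comp houtput))

theorem ListConfig.primrec_successors [Primcodable M.State] :
    Primrec (ListConfig.successors : M.ListConfig → List M.ListConfig) := by
  have htapes : Primrec fun c : M.ListConfig => c.2 := Primrec.snd
  have henabled := Primrec.dom_finite fun x : M.State × Option D × Option D =>
    M.enabled x.1 x.2.1 x.2.2
  exact Primrec.list_map (henabled.comp (Primrec.fst.pair
    ((ListTape.primrec_read.comp (Primrec.fst.comp htapes)).pair
      (ListTape.primrec_read.comp (Primrec.fst.comp (Primrec.snd.comp htapes))))))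
    ListConfig.primrec_next

theorem partrec_simulate : Partrec M.simulate := by
  let _ : Primcodable M.State := primcodableOfFinite _
  have hword : Primrec fun w : List D => ((w.map some, 0) : ListTape D) :=
    (Primrec.list_map Primrec.id (Primrec.option_some.comp Primrec.snd).to₂).pair
      (Primrec.const 0)
  have hstart : Primrec fun x : List D × List D × ℕ => M.listStart x.1 x.2.1 :=
    (Primrec.const M.start).pair ((hword.comp (Primrec.fst.comp Primrec.snd)).pair
      ((hword.comp Primrec.fst).pair (Primrec.const _)))
  have htapes : Primrec fun c : M.ListConfig => c.2.2 := Primrec.snd.comp Primrec.snd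
  have hcontents : Primrec fun c : M.ListConfig => (c.2.2.1.content, c.2.2.2.content) :=
    (ListTape.primrec_content.comp (Primrec.fst.comp htapes)).pair
      (ListTape.primrec_content.comp (Primrec.snd.comp htapes))
  exact ((ComputationTree.partrec_outcome ListConfig.primrec_successors).comp
    (hstart.pair (Primrec.snd.comp Primrec.snd)).to_comp).map (hcontents.comp Primrec.snd).to_comp

end Finite

end PTM

/-! ### The control program of a persistent Turing machine -/

namespace PTM

variable {D : Type u}

/-- The control states of `PTM.controlProgram`. In the input mode, `next` increments the guess and
`recv d` appends `d` to the input. In the output mode, `simulate` evaluates a macrostep, `out c`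
compares the next output symbol with `c`, where `none` stands for `#`, and `pop` removes it. -/
inductive Control (D : Type u) : Type u where
  | next : Control D
  | recv : D → Control D
  | simulate : Control D
  | out : Option D → Control D
  | pop : Control D

namespace Control

/-- The control states of the input mode. -/
def IsInput : Control D → Prop
  | next => True
  | recv _ => True
  | _ => False

instance [Finite D] : Finite (Control D) :=
  Finite.of_injective (β := Option D ⊕ Option D ⊕ Bool)
    (fun q => match q with
      | next => .inl none
      | recv d => .inl (some d)
      | out c => .inr (.inl c)
      | simulate => .inr (.inr false)
      | pop => .inr (.inr true))
    (by intro p q h; cases p <;> cases q <;> simp_all)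

/-- The transitions that `PTM.controlProgram` offers after an evaluation with the given flag. -/
inductive Offer : Control D → Bool → Option (PortAction D) → Control D → Prop where
  | recv (q b d) (hq : q.IsInput) : Offer q b (some (.recv (.data d))) (.recv d)
  | hash (q b) (hq : q.IsInput) : Offer q b (some (.recv .hash)) .simulate
  | next (q b) (hq : q.IsInput) : Offer q b none .next
  | simulate (b c) : Offer .simulate b none (.out c)
  | pop (b c) : Offer .pop b none (.out c)
  | retry (c c') : Offer (.out c) false none (.out c')
  | send (d) : Offer (.out (some d)) true (some (.send (.data d))) .pop
  | finish : Offer (.out none) true (some (.send .hash)) .next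

end Control

variable [Finite D] (M : PTM.{u, v} D)

open scoped Classical in
/-- The control program that simulates the encoding of a persistent Turing machine. In the input
mode the data are the work tape, the input received so far, and a guess; in the output mode they are
the work tape, the remaining output, and a number without meaning. -/
noncomputable def controlProgram :
    ControlProgram (PortAction D) (Control D) (List D × List D × ℕ) where
  run q x :=
    match q with
    | .next => Part.some ((x.1, x.2.1, x.2.2 + 1), true)
    | .recv d => Part.some ((x.1, x.2.1 ++ [d], x.2.2), true)
    | .simulate => (M.simulate x).map fun r => ((r.1, r.2, 0), true)
    | .out c => Part.some (x, decide (x.2.1.head? = c))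
    | .pop => Part.some ((x.1, x.2.1.tail, x.2.2), true)
  offer := Control.Offer

theorem partrec_controlProgram_run [Primcodable D] (q : Control D) :
    Partrec (M.controlProgram.run q) := by
  classical
  have hwork : Primrec fun x : List D × List D × ℕ => x.1 := Primrec.fst
  have hword : Primrec fun x : List D × List D × ℕ => x.2.1 := Primrec.fst.comp Primrec.snd
  have hguess : Primrec fun x : List D × List D × ℕ => x.2.2 := Primrec.snd.comp Primrec.snd
  have htrue {f : List D × List D × ℕ → List D × List D × ℕ} (hf : Primrec f) :
      Partrec fun x => Part.some (f x, true) := (hf.pair (Primrec.const true)).to_comp.partrec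
  cases q with
  | next => exact htrue (hwork.pair (hword.pair (Primrec.succ.comp hguess)))
  | recv d =>
    exact htrue (hwork.pair ((Primrec.list_concat.comp hword (Primrec.const d)).pair hguess))
  | simulate =>
    exact partrec_simulate.map (((Primrec.fst.comp Primrec.snd).pair
      ((Primrec.snd.comp Primrec.snd).pair (Primrec.const 0))).pair (Primrec.const true)).to_comp
  | out c =>
    exact (Primrec.id.pair (Primrec.eq.comp (Primrec.list_head?.comp hword)
      (Primrec.const c)).decide).to_comp.partrec
  | pop => exact htrue (hwork.pair ((Primrec.list_tail.comp hword).pair hguess))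

/-- The transition system of `PTM.controlProgram`. -/
noncomputable abbrev controlLTS : LTS (PortAction D) := M.controlProgram.toLTS .next ([], [], 0)

/-- The branching bisimulation between the encoding of a persistent Turing machine and its control
program. A state of the control program is related according to the value of its evaluation, and
to `s_{o,μ}` if the evaluation diverges. -/
inductive ControlRel : ITS.EncState M.toITS.State D → Control D × List D × List D × ℕ → Prop where
  | inp (s : M.toITS.State) (q x y b) (hq : q.IsInput) (hy : (y, b) ∈ M.controlProgram.run q x)
      (hs : s.1 = .word y.1) : ControlRel (.inp s y.2.1) (q, x)
  | out (s : M.toITS.State) (q x y b) (hq : ¬ q.IsInput) (hy : (y, b) ∈ M.controlProgram.run q x)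
      (hs : s.1 = .word y.1) : ControlRel (.out s (.word y.2.1)) (q, x)
  | div (s : M.toITS.State) (q x) (hq : ¬ (M.controlProgram.run q x).Dom)
      (hs : s.1 = .infinity) : ControlRel (.out s .mu) (q, x)

variable {M} {s : M.toITS.State} {q : Control D} {x y : List D × List D × ℕ} {b : Bool}

namespace ControlRel

theorem inp_next (hs : s.1 = .word x.1) : M.ControlRel (.inp s x.2.1) (.next, x) :=
  .inp s .next x (x.1, x.2.1, x.2.2 + 1) true trivial (Part.mem_some _) hs

theorem inp_recv (hs : s.1 = .word x.1) (d : D) :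
    M.ControlRel (.inp s (x.2.1 ++ [d])) (.recv d, x) :=
  .inp s (.recv d) x (x.1, x.2.1 ++ [d], x.2.2) true trivial (Part.mem_some _) hs

theorem out_out (hs : s.1 = .word x.1) (c : Option D) :
    M.ControlRel (.out s (.word x.2.1)) (.out c, x) :=
  .out s (.out c) x x _ id (Part.mem_some _) hs

theorem out_pop (hs : s.1 = .word x.1) : M.ControlRel (.out s (.word x.2.1.tail)) (.pop, x) :=
  .out s .pop x (x.1, x.2.1.tail, x.2.2) true id (Part.mem_some _) hs

end ControlRel

theorem exists_taus_of_guess_le (hq : q.IsInput) (hy : (y, b) ∈ M.controlProgram.run q x) {e : ℕ}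
    (he : y.2.2 ≤ e) : ∃ q' x' b', q'.IsInput ∧
      ((y.1, y.2.1, e), b') ∈ M.controlProgram.run q' x' ∧ M.controlLTS.taus (q, x) (q', x') := by
  induction e, he using Nat.le_induction with
  | base => exact ⟨q, x, b, hq, hy, .refl⟩
  | succ e _ ih =>
    obtain ⟨q', x', b', hq', hy', htaus⟩ := ih
    exact ⟨.next, (y.1, y.2.1, e), true, trivial, Part.mem_some _,
      htaus.tail ⟨b', hy', .next q' b' hq'⟩⟩

theorem mem_run_out_iff {c : Option D} :
    (y, b) ∈ M.controlProgram.run (.out c) x ↔ y = x ∧ (b = true ↔ x.2.1.head? = c) := by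
  classical
  refine Part.mem_some_iff.trans (Prod.mk_inj.trans (and_congr_right fun _ => ?_))
  rw [Bool.eq_iff_iff, decide_eq_true_iff]

theorem taus_out_head? (hq : ¬ q.IsInput) (hy : (y, b) ∈ M.controlProgram.run q x) :
    M.controlLTS.taus (q, x) (.out y.2.1.head?, y) := by
  cases q with
  | next => exact absurd trivial hq
  | recv d => exact absurd trivial hq
  | simulate => exact .single ⟨b, hy, .simulate b _⟩
  | pop => exact .single ⟨b, hy, .pop b _⟩
  | out c =>
    obtain ⟨rfl, -⟩ := mem_run_out_iff.1 hy
    by_cases h : y.2.1.head? = c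
    · rw [h]
      exact .refl
    · exact .single ⟨false, mem_run_out_iff.2 ⟨rfl, by simpa using h⟩, .retry c _⟩

theorem exists_controlLTS_step_of_step_inp (hq : q.IsInput)
    (hy : (y, b) ∈ M.controlProgram.run q x) (hs : s.1 = .word y.1) {a : Option (PortAction D)}
    {t : M.toLTS.State} (ht : M.toLTS.step (.inp s y.2.1) a t) :
    ∃ u v, M.controlLTS.taus (q, x) u ∧ M.controlLTS.step u a v ∧
      M.ControlRel (.inp s y.2.1) u ∧ M.ControlRel t v := by
  cases ht with
  | recv _ _ d =>
    exact ⟨(q, x), (.recv d, y), .refl, ⟨b, hy, .recv q b d hq⟩, .inp s q x y b hq hy hs,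
      .inp_recv hs d⟩
  | macrostep _ _ wo t htr =>
    have hmacrostep : M.Macrostep (.word y.1) y.2.1 wo t.1 := hs ▸ htr
    obtain ⟨e, he, hresult⟩ := exists_ge_simulate_of_macrostep hmacrostep y.2.2
    obtain ⟨q', x', b', hq', hy', htaus⟩ := exists_taus_of_guess_le hq hy he
    refine ⟨(q', x'), (.simulate, y.1, y.2.1, e), htaus, ⟨b', hy', .hash q' b' hq'⟩,
      .inp s q' x' (y.1, y.2.1, e) b' hq' hy' hs, ?_⟩
    rcases hresult with ⟨r, hr, rfl, hts⟩ | ⟨hdom, rfl, hts⟩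
    · exact .out t .simulate _ (r.1, r.2, 0) true id (Part.mem_map _ hr) hts
    · exact .div t .simulate _ hdom hts

theorem exists_controlLTS_step_of_step_out (hq : ¬ q.IsInput)
    (hy : (y, b) ∈ M.controlProgram.run q x) (hs : s.1 = .word y.1) {a : Option (PortAction D)}
    {t : M.toLTS.State} (ht : M.toLTS.step (.out s (.word y.2.1)) a t) :
    ∃ u v, M.controlLTS.taus (q, x) u ∧ M.controlLTS.step u a v ∧
      M.ControlRel (.out s (.word y.2.1)) u ∧ M.ControlRel t v := by
  obtain ⟨w, wo, e⟩ := y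
  have htaus := taus_out_head? hq hy
  cases ht with
  | send _ d wo =>
    exact ⟨_, (.pop, w, d :: wo, e), htaus, ⟨true, mem_run_out_iff.2 ⟨rfl, by simp⟩, .send d⟩,
      .out_out (x := (w, d :: wo, e)) hs _, .out_pop (x := (w, d :: wo, e)) hs⟩
  | finish =>
    exact ⟨_, (.next, w, [], e), htaus, ⟨true, mem_run_out_iff.2 ⟨rfl, by simp⟩, .finish⟩,
      .out_out (x := (w, [], e)) hs _, .inp_next (x := (w, [], e)) hs⟩

theorem exists_step_inp_of_hash (hs : s.1 = .word y.1) :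
    ∃ t, M.toLTS.step (.inp s y.2.1) (some (.recv .hash)) t ∧ M.ControlRel t (.simulate, y) := by
  by_cases hdom : (M.simulate y).Dom
  · obtain ⟨r, hr⟩ := Part.dom_iff_mem.1 hdom
    have hmacrostep : M.Macrostep s.1 y.2.1 (.word r.2) (.word r.1) :=
      hs ▸ macrostep_of_mem_simulate hr
    let t : M.toITS.State := ⟨.word r.1, s.2.tail ⟨_, _, hmacrostep⟩⟩
    exact ⟨_, .macrostep s _ _ t hmacrostep,
      .out t .simulate y (r.1, r.2, 0) true id (Part.mem_map _ hr) rfl⟩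
  · have hmacrostep : M.Macrostep s.1 y.2.1 .mu .infinity :=
      hs ▸ macrostep_of_not_simulate_dom hdom
    let t : M.toITS.State := ⟨.infinity, s.2.tail ⟨_, _, hmacrostep⟩⟩
    exact ⟨_, .macrostep s _ _ t hmacrostep, .div t .simulate y hdom rfl⟩

theorem exists_optStep_inp_of_offer (hq : q.IsInput) (hs : s.1 = .word y.1)
    {a : Option (PortAction D)} {q' : Control D} (ho : q.Offer b a q') :
    ∃ t, M.toLTS.optStep (.inp s y.2.1) a t ∧ M.ControlRel t (q', y) := by
  cases ho with
  | recv _ _ d => exact ⟨_, .inl (.recv s _ d), .inp_recv hs d⟩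
  | next => exact ⟨_, .inr ⟨rfl, rfl⟩, .inp_next hs⟩
  | hash =>
    obtain ⟨t, ht, hrel⟩ := exists_step_inp_of_hash hs
    exact ⟨t, .inl ht, hrel⟩
  | simulate | pop | retry | send | finish => cases hq

theorem exists_optStep_out_of_offer (hq : ¬ q.IsInput) (hy : (y, b) ∈ M.controlProgram.run q x)
    (hs : s.1 = .word y.1) {a : Option (PortAction D)} {q' : Control D} (ho : q.Offer b a q') :
    ∃ t, M.toLTS.optStep (.out s (.word y.2.1)) a t ∧ M.ControlRel t (q', y) := by
  cases ho with
  | recv _ _ _ hq' | hash _ _ hq' | next _ _ hq' => exact absurd hq' hq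
  | simulate | pop | retry => exact ⟨_, .inr ⟨rfl, rfl⟩, .out_out hs _⟩
  | send d =>
    obtain ⟨rfl, hhead⟩ := mem_run_out_iff.1 hy
    obtain ⟨w, wo, e⟩ := y
    obtain ⟨wo, rfl⟩ : ∃ l, wo = d :: l := List.head?_eq_some_iff.1 (hhead.1 rfl)
    exact ⟨_, .inl (.send s d wo), .out_pop (x := (w, d :: wo, e)) hs⟩
  | finish =>
    obtain ⟨rfl, hhead⟩ := mem_run_out_iff.1 hy
    obtain ⟨w, wo, e⟩ := y
    obtain rfl : wo = [] := List.head?_eq_none_iff.1 (hhead.1 rfl)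
    exact ⟨_, .inl (.finish s), .inp_next (x := (w, [], e)) hs⟩

theorem isBranchingBisimulation_controlRel :
    LTS.IsBranchingBisimulation M.toLTS M.controlLTS M.ControlRel where
  step_left := by
    rintro s₁ s₂ hrel a t₁ ht
    cases hrel with
    | inp s q x y b hq hy hs =>
      obtain ⟨u, v, htaus, hstep, hu, hv⟩ := exists_controlLTS_step_of_step_inp hq hy hs ht
      exact ⟨u, v, htaus, .inl hstep, hu, hv⟩
    | out s q x y b hq hy hs =>
      obtain ⟨u, v, htaus, hstep, hu, hv⟩ := exists_controlLTS_step_of_step_out hq hy hs ht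
      exact ⟨u, v, htaus, .inl hstep, hu, hv⟩
    | div s q x hq hs =>
      cases ht
      exact ⟨(q, x), (q, x), .refl, .inr ⟨rfl, rfl⟩, .div s q x hq hs, .div s q x hq hs⟩
  step_right := by
    rintro s₁ s₂ hrel a ⟨q', y'⟩ ⟨b', hy', ho⟩
    refine ⟨s₁, ?_⟩
    suffices ∃ t, M.toLTS.optStep s₁ a t ∧ M.ControlRel t (q', y') from
      this.imp fun t ⟨hstep, ht⟩ => ⟨.refl, hstep, hrel, ht⟩
    cases hrel with
    | inp s q x y b hq hy hs =>
      obtain ⟨rfl, rfl⟩ := Prod.mk_inj.1 (Part.mem_unique hy' hy)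
      exact exists_optStep_inp_of_offer hq hs ho
    | out s q x y b hq hy hs =>
      obtain ⟨rfl, rfl⟩ := Prod.mk_inj.1 (Part.mem_unique hy' hy)
      exact exists_optStep_out_of_offer hq hy hs ho
    | div s q x hq hs => exact absurd (Part.dom_iff_mem.2 ⟨_, hy'⟩) hq
  final_left := by rintro _ _ _ ⟨⟩
  final_right := by rintro _ _ _ ⟨⟩

variable (M) in
theorem branchingBisimilar_controlLTS : LTS.BranchingBisimilar M.toLTS M.controlLTS :=
  ⟨M.ControlRel, isBranchingBisimulation_controlRel, .inp_next (x := ([], [], 0)) rfl⟩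

end PTM

theorem mainTheorem8_general : ∃ X : Type, Finite X ∧ ∀ {D : Type u} [Finite D] {E : Type*},
    (X ↪ E) → ∀ M : PTM.{u, v} D, ∃ N : RTM (PortAction D) E,
      LTS.BranchingBisimilar M.toLTS N.toLTS := by
  classical
  refine ⟨TapeSymbol, inferInstance, fun {D _ E} f M => ?_⟩
  let _ : Primcodable D := primcodableOfFinite D
  let i : PointedMap TapeSymbol (Option E) :=
    ⟨fun x => if x = default then none else some (f x), if_pos rfl⟩
  have hi : Function.Injective i := by
    intro x y h
    change (if x = default then none else some (f x)) =
      if y = default then none else some (f y) at h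
    split_ifs at h with hx hy hy
    · exact hx.trans hy.symm
    · exact f.injective (Option.some_injective _ h)
  obtain ⟨N, hN⟩ := M.controlProgram.exists_rtm M.partrec_controlProgram_run .next ([], [], 0) hi
  exact ⟨N, M.branchingBisimilar_controlLTS.trans hN⟩

theorem mainTheorem8 {D : Type u} [Finite D] :
    ∃ X : Type, Finite X ∧ ∀ M : PTM.{u, v} D, ∃ N : RTM (PortAction D) (D ⊕ X),
      LTS.BranchingBisimilar M.toLTS N.toLTS := by
  obtain ⟨X, hX, h⟩ := mainTheorem8_general
  exact ⟨X, hX, h .inr⟩
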